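/- Let $E$ be a Polish space with its Borel $\sigma$-algebra, let $(X_t,(\mathbb P_x)_{x\in E})_{t\ge 0}$ be a conservative (jointly measurable) time-homogeneous Markov process on $E$ with semigroup $P_tf(x)=\mathbb E_x[f(X_t)]$, let $\mu$ be an invariant probability measure, and let $\mathbb P_\mu=\int \mathbb P_x\,\mu(dx)$ be the law of the stationary process. Assume that there is a non-increasing function $\eta:[0,\infty)\to[0,\infty)$ such that $$\mathrm{Var}_\mu(P_tf)\le \eta(t)\,\Big\|f-\int f\,d\mu\Big\|_\infty^2\qquad\text{for all bounded measurable } f \text{ and all } t\ge 0 .$$ Let $\alpha:[0,\infty)\to\mathbb R$ be one of the following functions: (a) the strong mixing coefficient of the stationary process, $\alpha(r)=\sup_{s,F,G}|\mathrm{Cov}_{\mathbb P_\mu}(F,G)|$, where $s\ge 0$, $F$ is $\sigma(X_u,u\le s)$-measurable, $G$ is $\sigma(X_u,u\ge s+r)$-measurable, and both take values in $[0,1]$; (b) its upper bound $\alpha(r)=\sqrt{\eta(r)}$; (c) if $\mu$ is moreover symmetric (reversible) for $(P_t)$, its upper bound $\alpha(r)=\eta(r/2)$. Let $k\ge 2$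 be an integer such that $M_k(\alpha):=\sup_{r\ge 0}(1+r)^k\alpha(r)<\infty$. Then there is a constant $C(k)>0$, depending only on $k$, such that for all measurable $V:E\to\mathbb R$ with $\sup|V|=1$, all $0<R\le 1$ and all $t>0$ with $t(1-R)<[t]$, where $[t]$ denotes the integer part of $t$, $$\mathbb P_\mu\left(\frac1t\int_0^tV(X_s)\,ds-\int V\,d\mu\ \ge\ R\right)\ \le\ \frac{C(k)\,M_k(\alpha)}{t^k\,\big(R-(1-[t]/t)\big)^{2k}} .$$ -/

import Mathlib

open MeasureTheory ProbabilityTheory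
open scoped NNReal ENNReal

/-- The past `σ(X_u, u ≤ s)` of a process. -/
abbrev pastSigma {Ω E : Type*} [MeasurableSpace E] (X : ℝ≥0 → Ω → E) (s : ℝ≥0) :
    MeasurableSpace Ω :=
  ⨆ u : Set.Iic s, MeasurableSpace.comap (X u) inferInstance

/-- The future `σ(X_u, u ≥ s)` of a process. -/
abbrev futureSigma {Ω E : Type*} [MeasurableSpace E] (X : ℝ≥0 → Ω → E) (s : ℝ≥0) :
    MeasurableSpace Ω :=
  ⨆ u : Set.Ici s, MeasurableSpace.comap (X u) inferInstance

/-- A conservative time-homogeneous Markov process `(X_t, (P_x)_{x ∈ E})` with continuous time and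
jointly measurable paths. -/
structure MarkovProcess (Ω E : Type*) [MeasurableSpace Ω] [MeasurableSpace E] where
  /-- the process -/
  X : ℝ≥0 → Ω → E
  /-- the law `P_x` of the process started at `x` -/
  law : Kernel E Ω
  isMarkovKernel_law : IsMarkovKernel law
  measurable_uncurry : Measurable (fun p : ℝ≥0 × Ω => X p.1 p.2)
  start : ∀ x : E, ∀ᵐ ω ∂(law x), X 0 ω = x
  /-- the simple Markov property
  `P_x(A ∩ {X_{s+t} ∈ B}) = E_x[1_A P_{X_s}(X_t ∈ B)]` for `A` in the past of time `s` -/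
  markov : ∀ (x : E) (s t : ℝ≥0) (A : Set Ω) (B : Set E),
    MeasurableSet[pastSigma X s] A → MeasurableSet B →
      law x (A ∩ X (s + t) ⁻¹' B) = ∫⁻ ω in A, (law (X s ω)).map (X t) B ∂(law x)

namespace MarkovProcess

variable {Ω E : Type*} [MeasurableSpace Ω] [MeasurableSpace E]

/-- The transition kernel `P_t(x, ·)`, the law of `X_t` under `P_x`. -/
noncomputable def transition (Y : MarkovProcess Ω E) (t : ℝ≥0) : Kernel E E :=
  Y.law.map (Y.X t)

/-- The semigroup `P_t f (x) = E_x[f(X_t)]`. -/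
noncomputable def semigroup (Y : MarkovProcess Ω E) (t : ℝ≥0) (f : E → ℝ) (x : E) : ℝ :=
  ∫ y, f y ∂(Y.transition t x)

/-- The law `P_μ = ∫ P_x μ(dx)` of the process with initial distribution `μ`. -/
noncomputable def lawFrom (Y : MarkovProcess Ω E) (μ : Measure E) : Measure Ω :=
  μ.bind Y.law

/-- `μ` is an invariant measure of the semigroup. -/
def IsInvariant (Y : MarkovProcess Ω E) (μ : Measure E) : Prop :=
  ∀ t, (Y.transition t).Invariant μ

/-- `μ` is symmetric (reversible) for the semigroup. -/
def IsSymmetric (Y : MarkovProcess Ω E) (μ : Measure E) : Prop :=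
  ∀ t, (Y.transition t).IsReversible μ

/-- The decay property: `η` is nonincreasing on `[0, ∞)` and
`Var_μ(P_t f) ≤ η(t) ‖f - ∫ f dμ‖_∞²` for all bounded measurable `f` and all `t ≥ 0`. -/
def Decay (Y : MarkovProcess Ω E) (μ : Measure E) (η : ℝ≥0 → ℝ≥0) : Prop :=
  Antitone η ∧
    ∀ f : E → ℝ, Measurable f → (∃ c : ℝ, ∀ x, |f x| ≤ c) → ∀ t : ℝ≥0,
      variance (Y.semigroup t f) μ ≤ (η t : ℝ) * (⨆ x, |f x - ∫ y, f y ∂μ|) ^ 2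

end MarkovProcess

/-- The strong mixing coefficient of a process: `α(r)` is the supremum of `|Cov(F, G)|` over all
`s ≥ 0` and all `[0, 1]`-valued `F`, `G` that are measurable for the past of time `s` and for the
future of time `s + r`, respectively. -/
noncomputable def strongMixing {Ω E : Type*} [MeasurableSpace Ω] [MeasurableSpace E]
    (X : ℝ≥0 → Ω → E) (P : Measure Ω) (r : ℝ≥0) : ℝ :=
  sSup {c : ℝ | ∃ (s : ℝ≥0) (F G : Ω → ℝ),
    Measurable[pastSigma X s] F ∧ Measurable[futureSigma X (s + r)] G ∧
    (∀ ω, F ω ∈ Set.Icc (0 : ℝ) 1) ∧ (∀ ω, G ω ∈ Set.Icc (0 : ℝ) 1) ∧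
    c = |covariance F G P|}

/-- `M_k(α) < ∞`. -/
def FiniteMixingMoment (k : ℕ) (α : ℝ≥0 → ℝ) : Prop :=
  BddAbove (Set.range fun r : ℝ≥0 => (1 + (r : ℝ)) ^ k * α r)

/-- `M_k(α) = sup_{r ≥ 0} (1 + r)^k α(r)`. -/
noncomputable def mixingMoment (k : ℕ) (α : ℝ≥0 → ℝ) : ℝ :=
  ⨆ r : ℝ≥0, (1 + (r : ℝ)) ^ k * α r

/-! The proof bounds the `2k`-th moment of the centered time integral by `C * M * t ^ k`, where `M`
is the mixing moment, and applies Markov's inequality. This gives the estimate with `R` itself,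
which is stronger because `R - (1 - [t]/t) ≤ R`. If `M ≥ t ^ k` the claim is trivial.

For a centered stationary sequence of length `N`, the `2k`-th moment of its sum expands over tuples
of times. By symmetry, ordered tuples suffice up to a factor `(2k)!`. By stationarity an ordered
tuple matters only through its `2k - 1` gaps, and the free first time contributes a factor `N`.
Cutting at a largest gap `r`, mixing replaces the expectation by a product of two shorter ones, with
error `γ r`; at most `(r + 1) ^ n` choices of the other `n` gaps are compatible with `r` being
largest. Induction on the number of gaps (`gridSum_abs_succ_le`, `exists_gridSum_abs_le`) then
yields `C * κ * N ^ k` when `γ r` is of order `κ / (r + 1) ^ k` with `κ ≤ 1`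
(`exists_integral_pow_sum_le`).

Linear dependence on `M` comes from the grid step. With step `h` comparable to `ℓ = max(1, M) ^
(1/k)`, the correlations along the grid have `κ = min 1 M`, and `κ * ℓ ^ k = M` (`exists_grid`).
Jensen's inequality transfers the moment bound from grids to the integral
(`integral_pow_timeIntegral_le`), at the cost `h ^ (2k)`; since `N * h = t`, the total is of order
`κ * h ^ k * t ^ k`, hence of order `M * t ^ k`.

All three choices of `α` enter only through the correlation bound `4 * α r` for products along the
path (`abs_integral_pathProd_mul_sub_le`). -/

/-! ### Combinatorics of gap lists -/

/-- The sum of `f` over all lists of length `n` with entries smaller than `N`. -/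
def gridSum (N : ℕ) : ℕ → (List ℕ → ℝ) → ℝ
  | 0, f => f []
  | n + 1, f => ∑ d ∈ Finset.range N, gridSum N n fun l => f (d :: l)

section gridSum

variable {N : ℕ}

lemma gridSum_mono (n : ℕ) {f g : List ℕ → ℝ}
    (h : ∀ l : List ℕ, l.length = n → (∀ x ∈ l, x < N) → f l ≤ g l) :
    gridSum N n f ≤ gridSum N n g := by
  induction n generalizing f g with
  | zero => exact h [] rfl (by simp)
  | succ n ih =>
    refine Finset.sum_le_sum fun d hd => ih fun l hl hx => h _ (by simp [hl]) ?_
    simpa using ⟨Finset.mem_range.1 hd, hx⟩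

lemma gridSum_finset_sum {ι : Type*} (s : Finset ι) (n : ℕ) (f : ι → List ℕ → ℝ) :
    gridSum N n (fun l => ∑ i ∈ s, f i l) = ∑ i ∈ s, gridSum N n (f i) := by
  induction n generalizing f with
  | zero => rfl
  | succ n ih =>
    simp only [gridSum, ih]
    exact Finset.sum_comm

lemma gridSum_add (n : ℕ) (f g : List ℕ → ℝ) :
    gridSum N n (fun l => f l + g l) = gridSum N n f + gridSum N n g := by
  induction n generalizing f g with
  | zero => rfl
  | succ n ih => simp only [gridSum, ih, Finset.sum_add_distrib]

lemma gridSum_const_mul (n : ℕ) (c : ℝ) (f : List ℕ → ℝ) :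
    gridSum N n (fun l => c * f l) = c * gridSum N n f := by
  induction n generalizing f with
  | zero => rfl
  | succ n ih => simp only [gridSum, ih, Finset.mul_sum]

lemma gridSum_mul_const (n : ℕ) (c : ℝ) (f : List ℕ → ℝ) :
    gridSum N n (fun l => f l * c) = gridSum N n f * c := by
  simpa only [mul_comm c] using gridSum_const_mul n c f

lemma gridSum_nonneg (n : ℕ) {f : List ℕ → ℝ} (h : ∀ l, 0 ≤ f l) : 0 ≤ gridSum N n f := by
  induction n generalizing f with
  | zero => exact h []
  | succ n ih => exact Finset.sum_nonneg fun d _ => ih fun l => h _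

lemma gridSum_split (m b : ℕ) (f : List ℕ → ℝ) :
    gridSum N (m + b + 1) f =
      gridSum N m fun l₁ => ∑ r ∈ Finset.range N, gridSum N b fun l₂ => f (l₁ ++ r :: l₂) := by
  induction m generalizing f with
  | zero => simp [gridSum]
  | succ m ih =>
    rw [show m + 1 + b + 1 = (m + b + 1) + 1 by omega]
    exact Finset.sum_congr rfl fun d _ => ih _

/-- Counts the gaps compatible with `r` being the largest one. -/
lemma gridSum_indicator_le (n r : ℕ) :
    gridSum N n (fun l => if ∀ x ∈ l, x ≤ r then (1 : ℝ) else 0) ≤ ((r : ℝ) + 1) ^ n := by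
  induction n with
  | zero => simp [gridSum]
  | succ n ih =>
    have h1 : ∀ d, gridSum N n (fun l => if ∀ x ∈ d :: l, x ≤ r then (1 : ℝ) else 0) ≤
        if d ≤ r then ((r : ℝ) + 1) ^ n else 0 := by
      intro d
      split_ifs with hd
      · simpa [hd] using ih
      · have := gridSum_const_mul (N := N) n 0 (fun _ => 0)
        simp [hd] at this ⊢
        exact this.le
    calc _ ≤ ∑ d ∈ Finset.range N, if d ≤ r then ((r : ℝ) + 1) ^ n else 0 :=
          Finset.sum_le_sum fun d _ => h1 d
      _ = ∑ d ∈ (Finset.range N).filter (· ≤ r), ((r : ℝ) + 1) ^ n := by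
          rw [Finset.sum_filter]
      _ ≤ ∑ d ∈ Finset.range (r + 1), ((r : ℝ) + 1) ^ n := by
          refine Finset.sum_le_sum_of_subset_of_nonneg (fun d hd => ?_) fun _ _ _ => by positivity
          simp at hd ⊢
          omega
      _ = ((r : ℝ) + 1) ^ (n + 1) := by
          simp [pow_succ]
          ring

/-- A nonempty list splits at a largest entry. -/
lemma exists_split_at_max (l : List ℕ) (hl : l ≠ []) :
    ∃ l₁ r l₂, l = l₁ ++ r :: l₂ ∧ ∀ x ∈ l, x ≤ r := by
  obtain ⟨r, hr, hmax⟩ := l.toFinset.exists_max_image id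
    (by simpa [List.toFinset_nonempty_iff] using hl)
  obtain ⟨l₁, l₂, h⟩ := List.append_of_mem (List.mem_toFinset.1 hr)
  exact ⟨l₁, r, l₂, h, fun x hx => hmax x (List.mem_toFinset.2 hx)⟩

/-- Splitting each list at its largest entry. -/
lemma gridSum_abs_succ_le {φ : List ℕ → ℝ} {γ : ℕ → ℝ} (hγ : ∀ r, 0 ≤ γ r)
    (h : ∀ l₁ r l₂, |φ (l₁ ++ r :: l₂) - φ l₁ * φ l₂| ≤ γ r) (n : ℕ) :
    gridSum N (n + 1) (fun l => |φ l|) ≤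
      ∑ m ∈ Finset.range (n + 1),
        (N * gridSum N m (fun l => |φ l|) * gridSum N (n - m) (fun l => |φ l|) +
          ∑ r ∈ Finset.range N, γ r * ((r : ℝ) + 1) ^ n) := by
  -- `G m` is the bound that holds when a largest entry sits at position `m`. As `G` is nonnegative,
  -- summing over all positions avoids choosing one. The default `0` of `getD` is never reached at
  -- the positions used.
  let G : ℕ → List ℕ → ℝ := fun m l => |φ (l.take m)| * |φ (l.drop (m + 1))| +
    if ∀ x ∈ l, x ≤ l.getD m 0 then γ (l.getD m 0) else 0
  have hG0 : ∀ m l, 0 ≤ G m l := fun m l => by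
    simp only [G]
    split_ifs
    · have := hγ (l.getD m 0)
      positivity
    · positivity
  have hG : ∀ l : List ℕ, l.length = n + 1 → |φ l| ≤ ∑ m ∈ Finset.range (n + 1), G m l := by
    intro l hl
    obtain ⟨l₁, r, l₂, rfl, hr⟩ := exists_split_at_max l (by rintro rfl; simp at hl)
    have hm : l₁.length ∈ Finset.range (n + 1) := by
      simp at hl ⊢
      omega
    refine le_trans ?_ (Finset.single_le_sum (fun m _ => hG0 m _) hm)
    have e1 : (l₁ ++ r :: l₂).getD l₁.length 0 = r := by simp
    have e2 : (l₁ ++ r :: l₂).take l₁.length = l₁ := by simp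
    have e3 : (l₁ ++ r :: l₂).drop (l₁.length + 1) = l₂ := by
      rw [List.drop_append]; simp
    simp only [G]
    rw [e1, e2, e3, if_pos hr, ← abs_mul]
    have h3 := abs_sub_abs_le_abs_sub (φ (l₁ ++ r :: l₂)) (φ l₁ * φ l₂)
    linarith [h l₁ r l₂]
  refine (gridSum_mono _ fun l hl _ => hG l hl).trans ?_
  rw [gridSum_finset_sum]
  refine Finset.sum_le_sum fun m hm => ?_
  have hmn : n + 1 = m + (n - m) + 1 := by
    have := Finset.mem_range.1 hm
    omega
  conv_lhs => rw [hmn, gridSum_split]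
  -- The maximality condition splits into separate conditions on `l₁` and `l₂`, so the sum
  -- factorizes for fixed `r`.
  have hI : ∀ l₁ : List ℕ, l₁.length = m → ∀ r l₂, G m (l₁ ++ r :: l₂) ≤
      |φ l₁| * |φ l₂| + (if ∀ x ∈ l₁, x ≤ r then (1 : ℝ) else 0) * γ r *
        (if ∀ x ∈ l₂, x ≤ r then (1 : ℝ) else 0) := by
    rintro l₁ rfl r l₂
    have e1 : (l₁ ++ r :: l₂).getD l₁.length 0 = r := by simp
    have e2 : (l₁ ++ r :: l₂).take l₁.length = l₁ := by simp
    have e3 : (l₁ ++ r :: l₂).drop (l₁.length + 1) = l₂ := by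
      rw [List.drop_append]; simp
    simp only [G]
    rw [e1, e2, e3]
    gcongr
    by_cases h1 : ∀ x ∈ l₁, x ≤ r
    · by_cases h2 : ∀ x ∈ l₂, x ≤ r
      · rw [if_pos h1, if_pos h2]
        split_ifs <;> simp [hγ r]
      · rw [if_neg fun h' => h2 fun x hx => h' x (by simp [hx])]
        simp [h2]
    · rw [if_neg fun h' => h1 fun x hx => h' x (by simp [hx])]
      simp [h1]
  refine (gridSum_mono m fun l₁ hl₁ _ => Finset.sum_le_sum fun r _ =>
    gridSum_mono (n - m) fun l₂ _ _ => hI l₁ hl₁ r l₂).trans ?_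
  simp only [gridSum_add, gridSum_const_mul, Finset.sum_add_distrib, gridSum_finset_sum,
    gridSum_mul_const, Finset.sum_const, Finset.card_range, nsmul_eq_mul]
  refine add_le_add (le_of_eq (by ring)) (Finset.sum_le_sum fun r _ => ?_)
  have := gridSum_indicator_le (N := N) m r
  have := gridSum_indicator_le (N := N) (n - m) r
  have h0 : 0 ≤ gridSum N m (fun l => if ∀ x ∈ l, x ≤ r then (1 : ℝ) else 0) :=
    gridSum_nonneg _ fun l => by split_ifs <;> norm_num
  have h1 : 0 ≤ gridSum N (n - m) (fun l => if ∀ x ∈ l, x ≤ r then (1 : ℝ) else 0) :=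
    gridSum_nonneg _ fun l => by split_ifs <;> norm_num
  calc _ ≤ ((r : ℝ) + 1) ^ m * γ r * ((r : ℝ) + 1) ^ (n - m) := by
        have := hγ r
        gcongr
    _ = γ r * (((r : ℝ) + 1) ^ m * ((r : ℝ) + 1) ^ (n - m)) := by ring
    _ = γ r * ((r : ℝ) + 1) ^ n := by
        rw [← pow_add, Nat.add_sub_cancel' (by have := Finset.mem_range.1 hm; omega)]

lemma sum_inv_sq_le (N : ℕ) : ∑ r ∈ Finset.range N, 1 / ((r : ℝ) + 1) ^ 2 ≤ 2 := by
  have h : ∀ n : ℕ, ∑ r ∈ Finset.range (n + 1), 1 / ((r : ℝ) + 1) ^ 2 ≤ 2 - 1 / (n + 1 : ℝ) := by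
    intro n
    induction n with
    | zero => norm_num
    | succ n ih =>
      rw [Finset.sum_range_succ]
      have h1 : 1 / ((n : ℝ) + 1 + 1) ^ 2 ≤ 1 / (n + 1 : ℝ) - 1 / (n + 1 + 1 : ℝ) := by
        rw [div_sub_div _ _ (by positivity) (by positivity),
          div_le_div_iff₀ (by positivity) (by positivity)]
        nlinarith [(Nat.cast_nonneg n : (0 : ℝ) ≤ n)]
      push_cast
      linarith
  rcases N with _ | n
  · simp
  · have h0 : (0 : ℝ) ≤ 1 / (n + 1 : ℝ) := by positivity
    linarith [h n]

/-- Telescoping: each term is at most twice the increment of the square root. -/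
lemma sum_inv_sqrt_le (N : ℕ) : ∑ r ∈ Finset.range N, 1 / √((r : ℝ) + 1) ≤ 2 * √N := by
  induction N with
  | zero => simp
  | succ N ih =>
    rw [Finset.sum_range_succ]
    have h1 : 0 < √((N : ℝ) + 1) := by positivity
    have h2 : √(N : ℝ) ^ 2 = N := Real.sq_sqrt (by positivity)
    have h3 : √((N : ℝ) + 1) ^ 2 = N + 1 := Real.sq_sqrt (by positivity)
    have h4 : 1 / √((N : ℝ) + 1) ≤ 2 * √((N : ℝ) + 1) - 2 * √(N : ℝ) := by
      rw [div_le_iff₀ h1]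
      nlinarith [sq_nonneg (√((N : ℝ) + 1) - √(N : ℝ))]
    push_cast
    linarith

/-- Controls the mixing errors. Exponents `0` and `1` use the two preceding sums; from `2` on, each
of the `N` terms is at most `√N ^ (n - 2)`. -/
lemma sum_polynomial_decay_le {k : ℕ} (hk : 2 ≤ k) {n : ℕ} (hn : n + 2 ≤ 2 * k) :
    ∑ r ∈ Finset.range N, ((r : ℝ) + 1) ^ n / ((r : ℝ) + 1) ^ k ≤ 2 * √N ^ n := by
  rcases n with _ | _ | n
  · simp only [pow_zero, mul_one]
    refine le_trans (Finset.sum_le_sum fun r _ => ?_) (sum_inv_sq_le N)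
    gcongr
    linarith [(Nat.cast_nonneg r : (0 : ℝ) ≤ r)]
  · simp only [zero_add, pow_one]
    refine le_trans (Finset.sum_le_sum fun r _ => ?_) (sum_inv_sqrt_le N)
    have hr : (1 : ℝ) ≤ (r : ℝ) + 1 := by linarith [(Nat.cast_nonneg r : (0 : ℝ) ≤ r)]
    have h2 : ((r : ℝ) + 1) ^ 2 ≤ ((r : ℝ) + 1) ^ k := pow_le_pow_right₀ hr hk
    have h3 : √((r : ℝ) + 1) ≤ (r : ℝ) + 1 := Real.sqrt_le_self_iff.2 (Or.inr hr)
    rw [div_le_div_iff₀ (by positivity) (by positivity)]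
    nlinarith
  · have h1 : ∀ r ∈ Finset.range N,
        ((r : ℝ) + 1) ^ (n + 1 + 1) / ((r : ℝ) + 1) ^ k ≤ √N ^ n := by
      intro r hr
      have hr1 : (1 : ℝ) ≤ (r : ℝ) + 1 := by linarith [(Nat.cast_nonneg r : (0 : ℝ) ≤ r)]
      have hrN : (r : ℝ) + 1 ≤ N := by exact_mod_cast Finset.mem_range.1 hr
      rw [div_le_iff₀ (by positivity)]
      have hx : √((r : ℝ) + 1) ^ 2 = r + 1 := Real.sq_sqrt (by positivity)
      have hx1 : 1 ≤ √((r : ℝ) + 1) := Real.one_le_sqrt.2 hr1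
      calc ((r : ℝ) + 1) ^ (n + 1 + 1) = √((r : ℝ) + 1) ^ (2 * (n + 2)) := by rw [pow_mul, hx]
        _ ≤ √((r : ℝ) + 1) ^ (n + 2 * k) := pow_le_pow_right₀ hx1 (by omega)
        _ = √((r : ℝ) + 1) ^ n * ((r : ℝ) + 1) ^ k := by rw [pow_add, pow_mul, hx]
        _ ≤ √N ^ n * ((r : ℝ) + 1) ^ k := by gcongr
    refine (Finset.sum_le_sum h1).trans ?_
    have hN : √(N : ℝ) ^ 2 = N := Real.sq_sqrt (by positivity)
    simp only [Finset.sum_const, Finset.card_range, nsmul_eq_mul]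
    have : 0 ≤ √(N : ℝ) ^ n := by positivity
    calc (N : ℝ) * √N ^ n = √N ^ (n + 1 + 1) := by
          rw [pow_succ, pow_succ, mul_assoc, ← sq, hN]
          ring
      _ ≤ _ := by linarith [show 0 ≤ √(N : ℝ) ^ (n + 1 + 1) by positivity]

/-- Multilinear moments of a centered stationary sequence with polynomially decaying
correlations. -/
lemma exists_gridSum_abs_le {k : ℕ} (hk : 2 ≤ k) {D : ℝ} (hD : 0 ≤ D) (n : ℕ)
    (hn : n + 1 ≤ 2 * k) :
    ∃ C : ℝ, 0 ≤ C ∧ ∀ (N : ℕ) (κ : ℝ) (φ : List ℕ → ℝ) (γ : ℕ → ℝ), 0 ≤ κ → κ ≤ 1 →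
      (∀ r, 0 ≤ γ r) → (∀ r : ℕ, γ r ≤ D * κ / ((r : ℝ) + 1) ^ k) → φ [] = 0 →
      (∀ l₁ r l₂, |φ (l₁ ++ r :: l₂) - φ l₁ * φ l₂| ≤ γ r) →
      gridSum N n (fun l => |φ l|) ≤ C * κ * √N ^ (n - 1) := by
  induction n using Nat.strong_induction_on with
  | _ n ih =>
  rcases n with _ | n
  -- Centering, `φ [] = 0`, makes the truncated exponent `n - 1` harmless here.
  · exact ⟨0, le_rfl, fun N κ φ γ _ _ _ _ h0 _ => by simp [gridSum, h0]⟩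
  -- The bound on `m` is placed inside the existential so that `choose` gives a constant `c m` for
  -- every `m`.
  have ih' : ∀ m, ∃ C : ℝ, m < n + 1 → (0 ≤ C ∧ ∀ (N : ℕ) (κ : ℝ) (φ : List ℕ → ℝ) (γ : ℕ → ℝ),
      0 ≤ κ → κ ≤ 1 →
      (∀ r, 0 ≤ γ r) → (∀ r : ℕ, γ r ≤ D * κ / ((r : ℝ) + 1) ^ k) → φ [] = 0 →
      (∀ l₁ r l₂, |φ (l₁ ++ r :: l₂) - φ l₁ * φ l₂| ≤ γ r) →
      gridSum N m (fun l => |φ l|) ≤ C * κ * √N ^ (m - 1)) := by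
    intro m
    by_cases hm : m < n + 1
    · obtain ⟨C, hC⟩ := ih m hm (by omega)
      exact ⟨C, fun _ => hC⟩
    · exact ⟨0, fun h => absurd h hm⟩
  choose c hc using ih'
  refine ⟨∑ m ∈ Finset.range (n + 1), (c m * c (n - m) + 2 * D), Finset.sum_nonneg fun m hm => ?_,
    fun N κ φ γ hκ0 hκ1 hγ0 hγ h0 h => ?_⟩
  · have hm' := Finset.mem_range.1 hm
    have := (hc m hm').1
    have := (hc (n - m) (by omega)).1
    positivity
  refine (gridSum_abs_succ_le hγ0 h n).trans ?_
  rw [Finset.sum_mul, Finset.sum_mul]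
  refine Finset.sum_le_sum fun m hm => ?_
  have hm' := Finset.mem_range.1 hm
  have hcm := (hc m hm').1
  have hcn := (hc (n - m) (by omega)).1
  rw [add_mul, add_mul, Nat.add_sub_cancel]
  refine add_le_add ?_ ?_
  -- An empty block kills the product, so afterwards both blocks are nonempty and the exponents `m -
  -- 1` and `n - m - 1` are genuine.
  · rcases Nat.eq_zero_or_pos m with rfl | hm0
    · simp only [gridSum, h0, abs_zero, mul_zero, zero_mul]
      positivity
    rcases Nat.eq_zero_or_pos (n - m) with hn0 | hn0
    · simp only [hn0, gridSum, h0, abs_zero, mul_zero]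
      rw [hn0] at hcn
      positivity
    have b1 := (hc m hm').2 N κ φ γ hκ0 hκ1 hγ0 hγ h0 h
    have b2 := (hc (n - m) (by omega)).2 N κ φ γ hκ0 hκ1 hγ0 hγ h0 h
    have hN : √(N : ℝ) ^ 2 = N := Real.sq_sqrt (by positivity)
    have p1 : 0 ≤ gridSum N (n - m) (fun l => |φ l|) := gridSum_nonneg _ fun _ => abs_nonneg _
    calc (N : ℝ) * gridSum N m (fun l => |φ l|) * gridSum N (n - m) (fun l => |φ l|)
        ≤ √N ^ 2 * (c m * κ * √N ^ (m - 1)) * (c (n - m) * κ * √N ^ (n - m - 1)) := by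
          rw [hN]
          gcongr
      _ = c m * c (n - m) * (κ * κ) * (√N ^ 2 * √N ^ (m - 1) * √N ^ (n - m - 1)) := by ring
      _ = c m * c (n - m) * (κ * κ) * √N ^ n := by
          rw [← pow_add, ← pow_add]
          congr 2
          omega
      -- `κ ≤ 1` gives `κ * κ ≤ κ`, which keeps the bound linear in `κ`.
      _ ≤ c m * c (n - m) * κ * √N ^ n := by
          gcongr
          nlinarith
  · calc ∑ r ∈ Finset.range N, γ r * ((r : ℝ) + 1) ^ n
        ≤ ∑ r ∈ Finset.range N, D * κ * (((r : ℝ) + 1) ^ n / ((r : ℝ) + 1) ^ k) := by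
          refine Finset.sum_le_sum fun r _ => ?_
          calc γ r * ((r : ℝ) + 1) ^ n ≤ D * κ / ((r : ℝ) + 1) ^ k * ((r : ℝ) + 1) ^ n := by
                gcongr
                exact hγ r
            _ = _ := by ring
      _ = D * κ * ∑ r ∈ Finset.range N, ((r : ℝ) + 1) ^ n / ((r : ℝ) + 1) ^ k := by
          rw [Finset.mul_sum]
      _ ≤ D * κ * (2 * √N ^ n) := by
          gcongr
          exact sum_polynomial_decay_le hk (by omega)
      _ = 2 * D * κ * √N ^ n := by ring

end gridSum

/-! ### From tuples of times to gaps -/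

/-- The points `a + d₁, a + d₁ + d₂, …` reached from `a` with the increments `d₁, d₂, …`. -/
def runningSums (a : ℕ) : List ℕ → List ℕ
  | [] => []
  | d :: l => (a + d) :: runningSums (a + d) l

/-- Nondecreasing tuples are determined by their increments. -/
lemma sum_monotone_le_gridSum {N : ℕ} (n a : ℕ) {g : List ℕ → ℝ} (hg : ∀ l, 0 ≤ g l) :
    ∑ f : Fin n → Fin N, (if Monotone f ∧ ∀ i, a ≤ (f i : ℕ) then
        g (List.ofFn fun i => (f i : ℕ)) else 0) ≤
      gridSum N n fun d => g (runningSums a d) := by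
  induction n generalizing a g with
  | zero =>
    simp [gridSum, runningSums, Subsingleton.monotone]
  | succ n ih =>
    rw [← (Fin.consEquiv fun _ : Fin (n + 1) => Fin N).sum_comp, Fintype.sum_prod_type]
    have h1 : ∀ x : Fin N, ∑ f : Fin n → Fin N,
        (if Monotone (Fin.cons x f : Fin (n + 1) → Fin N) ∧
            ∀ i, a ≤ ((Fin.cons x f : Fin (n + 1) → Fin N) i : ℕ) then
          g (List.ofFn fun i => ((Fin.cons x f : Fin (n + 1) → Fin N) i : ℕ)) else 0) ≤
        if a ≤ x then gridSum N n fun d => g (x :: runningSums x d) else 0 := by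
      intro x
      split_ifs with hx
      · refine le_trans (Finset.sum_le_sum fun f _ => ?_)
          (ih x (g := fun l => g (x :: l)) fun l => hg _)
        by_cases hm : Monotone (Fin.cons x f : Fin (n + 1) → Fin N) ∧
            ∀ i, a ≤ ((Fin.cons x f : Fin (n + 1) → Fin N) i : ℕ)
        · rw [if_pos hm, if_pos]
          · simp [List.ofFn_succ]
          · refine ⟨fun i j hij => ?_, fun i => ?_⟩
            · simpa using hm.1 (Fin.succ_le_succ_iff.2 hij)
            · simpa using hm.1 (Fin.zero_le i.succ)
        · rw [if_neg hm]
          split_ifs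
          · exact hg _
          · exact le_rfl
      · refine (Finset.sum_eq_zero fun f _ => if_neg fun h => hx ?_).le
        simpa using h.2 0
    refine (Finset.sum_le_sum fun x _ => h1 x).trans ?_
    rw [← Finset.sum_filter]
    simp only [gridSum, runningSums]
    have hn : ∀ x, 0 ≤ gridSum N n fun d => g (x :: runningSums x d) :=
      fun x => gridSum_nonneg _ fun _ => hg _
    -- The shift `x ↦ x - a` is injective on `a ≤ x` and lands in `range N`. Only an inequality
    -- results, since increments below `N` may lead beyond `N`.
    rw [show ∑ x ∈ Finset.univ.filter (fun x : Fin N => a ≤ x),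
        (gridSum N n fun d => g ((x : ℕ) :: runningSums x d)) =
        ∑ x ∈ (Finset.univ.filter (fun x : Fin N => a ≤ x)).image (fun x : Fin N => (x : ℕ) - a),
          (gridSum N n fun d => g ((a + x) :: runningSums (a + x) d)) from ?_]
    · refine Finset.sum_le_sum_of_subset_of_nonneg (fun y hy => ?_) fun _ _ _ => hn _
      obtain ⟨x, _, rfl⟩ := Finset.mem_image.1 hy
      simp
      omega
    · rw [Finset.sum_image]
      · refine Finset.sum_congr rfl fun x hx => ?_
        rw [Nat.add_sub_cancel' (by simpa using hx)]
      · intro x hx y hy hxy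
        simp at hx hy hxy
        ext
        omega

/-- A sum over tuples of a nonnegative symmetric function is controlled by the sum over
nondecreasing tuples. -/
lemma sum_tuples_le_gridSum {N : ℕ} (n : ℕ) {g : List ℕ → ℝ} (hg : ∀ l, 0 ≤ g l)
    (hperm : ∀ l l' : List ℕ, l.Perm l' → g l = g l') :
    ∑ f : Fin n → Fin N, g (List.ofFn fun i => (f i : ℕ)) ≤
      n.factorial * gridSum N n fun d => g (runningSums 0 d) := by
  have h1 : ∀ f : Fin n → Fin N, g (List.ofFn fun i => (f i : ℕ)) ≤
      ∑ σ : Equiv.Perm (Fin n), if Monotone (f ∘ σ) then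
        g (List.ofFn fun i => ((f ∘ σ) i : ℕ)) else 0 := by
    intro f
    -- Ties allow several sorting permutations, but overcounting nonnegative terms is harmless.
    refine le_trans (le_of_eq ?_) (Finset.single_le_sum (fun σ _ => ?_)
      (Finset.mem_univ (Tuple.sort f)))
    · rw [if_pos (Tuple.monotone_sort f)]
      exact hperm _ _ (Equiv.Perm.ofFn_comp_perm (Tuple.sort f) fun i => (f i : ℕ)).symm
    · split_ifs
      · exact hg _
      · exact le_rfl
  refine (Finset.sum_le_sum fun f _ => h1 f).trans ?_
  rw [Finset.sum_comm]
  have h2 : ∀ σ : Equiv.Perm (Fin n), ∑ f : Fin n → Fin N, (if Monotone (f ∘ σ) then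
        g (List.ofFn fun i => ((f ∘ σ) i : ℕ)) else 0) ≤
      gridSum N n fun d => g (runningSums 0 d) := by
    intro σ
    refine le_trans (le_of_eq ((Equiv.arrowCongr σ.symm (Equiv.refl (Fin N))).sum_comp
      (fun f : Fin n → Fin N => if Monotone f then g (List.ofFn fun i => (f i : ℕ)) else 0))) ?_
    simpa using sum_monotone_le_gridSum (N := N) n 0 hg
  refine (Finset.sum_le_sum fun σ _ => h2 σ).trans ?_
  simp [Fintype.card_perm]

/-! ### Bounded integrands and products along a path -/

lemma integrable_of_abs_le {Ω : Type*} [MeasurableSpace Ω] {P : Measure Ω} [IsFiniteMeasure P]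
    {f : Ω → ℝ} (hf : Measurable f) (c : ℝ) (hc : ∀ ω, |f ω| ≤ c) : Integrable f P :=
  Integrable.of_bound hf.aestronglyMeasurable c (ae_of_all _ hc)

lemma abs_integral_le_of_abs_le {Ω : Type*} [MeasurableSpace Ω] {P : Measure Ω}
    [IsProbabilityMeasure P] {f : Ω → ℝ} {c : ℝ} (hc : ∀ ω, |f ω| ≤ c) :
    |∫ ω, f ω ∂P| ≤ c := by
  simpa using norm_integral_le_of_norm_le_const (μ := P) (f := f) (ae_of_all _ hc)

lemma integral_bind_kernel {α β : Type*} [MeasurableSpace α] [MeasurableSpace β] (μ : Measure α)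
    [IsFiniteMeasure μ] (κ : Kernel α β) [IsMarkovKernel κ] {f : β → ℝ} (hf : Measurable f)
    {c : ℝ} (hc : ∀ x, |f x| ≤ c) :
    ∫ y, f y ∂(μ.bind κ) = ∫ x, ∫ y, f y ∂(κ x) ∂μ := by
  have hi : Integrable f (μ.bind κ) := integrable_of_abs_le hf c hc
  rw [Measure.comp_eq_comp_const_apply] at hi ⊢
  rw [Kernel.integral_comp hi]
  simp

section pathProd

variable {Ω E : Type*}

/-- The product of `v` over the points of the path at the times with increments `l`, starting
from the time `s`. -/
def pathProd (X : ℝ≥0 → Ω → E) (v : E → ℝ) : ℝ≥0 → List ℝ≥0 → Ω → ℝ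
  | s, [], ω => v (X s ω)
  | s, d :: l, ω => v (X s ω) * pathProd X v (s + d) l ω

variable {X : ℝ≥0 → Ω → E} {v : E → ℝ}

lemma pathProd_append (s : ℝ≥0) (l₁ : List ℝ≥0) (r : ℝ≥0) (l₂ : List ℝ≥0) (ω : Ω) :
    pathProd X v s (l₁ ++ r :: l₂) ω =
      pathProd X v s l₁ ω * pathProd X v (s + l₁.sum + r) l₂ ω := by
  induction l₁ generalizing s with
  | nil => simp [pathProd]
  | cons d l ih => simp [pathProd, ih, mul_assoc, add_assoc]

lemma abs_pathProd_le (hv1 : ∀ x, |v x| ≤ 1) (s : ℝ≥0) (l : List ℝ≥0) (ω : Ω) :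
    |pathProd X v s l ω| ≤ 1 := by
  induction l generalizing s with
  | nil => exact hv1 _
  | cons d l ih =>
    rw [pathProd, abs_mul]
    exact mul_le_one₀ (hv1 _) (abs_nonneg _) (ih _)

lemma measurable_pathProd_of_forall [MeasurableSpace Ω] [MeasurableSpace E] (hv : Measurable v)
    (s : ℝ≥0) (l : List ℝ≥0) (hX : ∀ u, s ≤ u → u ≤ s + l.sum → Measurable (X u)) :
    Measurable (pathProd X v s l) := by
  induction l generalizing s with
  | nil => exact hv.comp (hX s le_rfl (by simp))
  | cons d l ih =>
    refine Measurable.mul (hv.comp (hX s le_rfl (by simp)))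
      (ih (s + d) fun u h1 h2 => hX u (le_trans (by simp) h1) ?_)
    simpa [add_assoc] using h2

end pathProd

/-! ### Markov property, stationarity and reversibility -/

namespace MarkovProcess

variable {Ω E : Type*} [MeasurableSpace Ω] [MeasurableSpace E] (Y : MarkovProcess Ω E)

instance : IsMarkovKernel Y.law := Y.isMarkovKernel_law

lemma measurable_X (t : ℝ≥0) : Measurable (Y.X t) :=
  Y.measurable_uncurry.comp (measurable_const.prodMk measurable_id)

instance (t : ℝ≥0) : IsMarkovKernel (Y.transition t) :=
  Kernel.IsMarkovKernel.map _ (Y.measurable_X t)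

instance (μ : Measure E) [IsProbabilityMeasure μ] : IsProbabilityMeasure (Y.lawFrom μ) := by
  unfold lawFrom
  infer_instance

variable {Y} {μ : Measure E}

lemma map_X_lawFrom (hμ : Y.IsInvariant μ) (t : ℝ≥0) : (Y.lawFrom μ).map (Y.X t) = μ :=
  (Measure.map_comp μ Y.law (Y.measurable_X t)).trans (hμ t)

lemma integral_comp_X (hμ : Y.IsInvariant μ) (t : ℝ≥0) {f : E → ℝ} (hf : Measurable f) :
    ∫ ω, f (Y.X t ω) ∂(Y.lawFrom μ) = ∫ x, f x ∂μ := by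
  conv_rhs => rw [← map_X_lawFrom hμ t]
  rw [integral_map (Y.measurable_X t).aemeasurable hf.aestronglyMeasurable]

variable (Y) in
lemma pastSigma_le (s : ℝ≥0) : pastSigma Y.X s ≤ ‹MeasurableSpace Ω› :=
  iSup_le fun u => (Y.measurable_X u).comap_le

variable (Y) in
lemma measurable_X_past {u s : ℝ≥0} (h : u ≤ s) : Measurable[pastSigma Y.X s] (Y.X u) :=
  (comap_measurable (Y.X u)).mono
    (le_iSup (fun u : Set.Iic s => MeasurableSpace.comap (Y.X u) inferInstance) ⟨u, h⟩) le_rfl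

variable (Y) in
lemma measurable_X_future {u s : ℝ≥0} (h : s ≤ u) : Measurable[futureSigma Y.X s] (Y.X u) :=
  (comap_measurable (Y.X u)).mono
    (le_iSup (fun u : Set.Ici s => MeasurableSpace.comap (Y.X u) inferInstance) ⟨u, h⟩) le_rfl

variable (Y) in
lemma pastSigma_mono {s t : ℝ≥0} (h : s ≤ t) : pastSigma Y.X s ≤ pastSigma Y.X t :=
  iSup_le fun u => (Y.measurable_X_past (le_trans u.2 h)).comap_le

lemma measurable_semigroup (t : ℝ≥0) {f : E → ℝ} (hf : Measurable f) :
    Measurable (Y.semigroup t f) :=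
  (StronglyMeasurable.integral_kernel hf.stronglyMeasurable).measurable

lemma abs_semigroup_le (t : ℝ≥0) {f : E → ℝ} {c : ℝ} (hc : ∀ x, |f x| ≤ c) (x : E) :
    |Y.semigroup t f x| ≤ c :=
  abs_integral_le_of_abs_le hc

lemma integral_semigroup [IsProbabilityMeasure μ] (hμ : Y.IsInvariant μ) (t : ℝ≥0) {f : E → ℝ}
    (hf : Measurable f) {c : ℝ} (hc : ∀ x, |f x| ≤ c) :
    ∫ x, Y.semigroup t f x ∂μ = ∫ x, f x ∂μ := by
  conv_rhs => rw [← (hμ t).def]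
  exact (integral_bind_kernel μ _ hf hc).symm

variable (Y) in
-- Chapman–Kolmogorov: the simple Markov property with `A = univ`.
lemma transition_add (s t : ℝ≥0) : Y.transition (s + t) = Y.transition t ∘ₖ Y.transition s := by
  ext x B hB
  have h := Y.markov x s t Set.univ B MeasurableSet.univ hB
  rw [Kernel.comp_apply' _ _ _ hB]
  unfold transition
  rw [Kernel.map_apply' _ (Y.measurable_X _) _ hB, Kernel.map_apply _ (Y.measurable_X s),
    lintegral_map (Kernel.measurable_coe _ hB) (Y.measurable_X s)]
  simpa [Kernel.map_apply _ (Y.measurable_X t)] using h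

lemma semigroup_add (s t : ℝ≥0) {f : E → ℝ} (hf : Measurable f) {c : ℝ} (hc : ∀ x, |f x| ≤ c)
    (x : E) : Y.semigroup (s + t) f x = Y.semigroup s (Y.semigroup t f) x := by
  unfold semigroup
  rw [transition_add, Kernel.integral_comp (integrable_of_abs_le hf c hc)]

/-- The Markov property of the process with initial distribution `μ`. -/
lemma setIntegral_markov [IsProbabilityMeasure μ] (s t : ℝ≥0) {A : Set Ω}
    (hA : MeasurableSet[pastSigma Y.X s] A) {f : E → ℝ} (hf : Measurable f) {c : ℝ}
    (hc : ∀ x, |f x| ≤ c) :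
    ∫ ω in A, Y.semigroup t f (Y.X s ω) ∂(Y.lawFrom μ) =
      ∫ ω in A, f (Y.X (s + t) ω) ∂(Y.lawFrom μ) := by
  have hA' : MeasurableSet A := Y.pastSigma_le s _ hA
  -- On the event `A`, the distribution of `X_{s+t}` is that of `X_s` pushed through the transition
  -- kernel; on sets this is the field `markov` integrated over the starting point.
  have h : ((Y.lawFrom μ).restrict A).map (Y.X (s + t)) =
      (((Y.lawFrom μ).restrict A).map (Y.X s)).bind (Y.transition t) := by
    ext B hB
    have hm : Measurable fun ω => Y.transition t (Y.X s ω) B :=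
      (Kernel.measurable_coe _ hB).comp (Y.measurable_X s)
    rw [Measure.map_apply (Y.measurable_X _) hB, Measure.restrict_apply (Y.measurable_X _ hB),
      Measure.bind_apply hB (Kernel.aemeasurable _),
      lintegral_map (Kernel.measurable_coe _ hB) (Y.measurable_X s), ← lintegral_indicator hA']
    unfold lawFrom
    rw [Measure.bind_apply ((Y.measurable_X _ hB).inter hA') (Kernel.aemeasurable _),
      Measure.lintegral_bind (Kernel.aemeasurable _) (hm.indicator hA').aemeasurable]
    refine lintegral_congr fun x => ?_
    rw [Set.inter_comm, Y.markov x s t A B hA hB, lintegral_indicator hA']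
    simp [transition, Kernel.map_apply _ (Y.measurable_X t)]
  rw [← integral_map (f := f) (Y.measurable_X _).aemeasurable hf.aestronglyMeasurable, h,
    integral_bind_kernel _ _ hf hc, integral_map (Y.measurable_X s).aemeasurable]
  · rfl
  · exact (measurable_semigroup t hf).aestronglyMeasurable

/-- The set version identifies `P_t f(X_s)` with the conditional expectation given the past, and `F`
can be pulled out. -/
lemma integral_mul_markov [IsProbabilityMeasure μ] (s t : ℝ≥0) {F : Ω → ℝ}
    (hF : Measurable[pastSigma Y.X s] F) (hF1 : ∀ ω, |F ω| ≤ 1) {f : E → ℝ} (hf : Measurable f)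
    {c : ℝ} (hc : ∀ x, |f x| ≤ c) :
    ∫ ω, F ω * f (Y.X (s + t) ω) ∂(Y.lawFrom μ) =
      ∫ ω, F ω * Y.semigroup t f (Y.X s ω) ∂(Y.lawFrom μ) := by
  have hm := Y.pastSigma_le s
  have hi : Integrable (fun ω => f (Y.X (s + t) ω)) (Y.lawFrom μ) :=
    integrable_of_abs_le (hf.comp (Y.measurable_X _)) c fun ω => hc _
  have hPm : Measurable[pastSigma Y.X s] fun ω => Y.semigroup t f (Y.X s ω) :=
    (measurable_semigroup t hf).comp (Y.measurable_X_past le_rfl)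
  have h1 : (fun ω => Y.semigroup t f (Y.X s ω)) =ᵐ[Y.lawFrom μ]
      (Y.lawFrom μ)[fun ω => f (Y.X (s + t) ω) | pastSigma Y.X s] := by
    refine ae_eq_condExp_of_forall_setIntegral_eq hm hi (fun A hA _ => ?_)
      (fun A hA _ => setIntegral_markov s t hA hf hc)
      (Measurable.stronglyMeasurable hPm).aestronglyMeasurable
    exact (integrable_of_abs_le (hPm.mono hm le_rfl) c
      fun ω => abs_semigroup_le t hc _).integrableOn
  have h2 := condExp_stronglyMeasurable_mul_of_bound hm (Measurable.stronglyMeasurable hF) hi 1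
    (ae_of_all _ hF1)
  rw [← integral_condExp hm (f := fun ω => F ω * f (Y.X (s + t) ω))]
  refine integral_congr_ae (h2.trans ?_)
  filter_upwards [h1] with ω hω
  simp [hω]

/-- The expectation of `pathProd` given the starting point. -/
noncomputable def pathExp (Y : MarkovProcess Ω E) (v : E → ℝ) : List ℝ≥0 → E → ℝ
  | [], x => v x
  | d :: l, x => v x * Y.semigroup d (pathExp Y v l) x

variable {v : E → ℝ}

lemma measurable_pathProd_past (hv : Measurable v) (s : ℝ≥0) (l : List ℝ≥0) :
    Measurable[pastSigma Y.X (s + l.sum)] (pathProd Y.X v s l) :=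
  @measurable_pathProd_of_forall _ _ _ _ (pastSigma Y.X (s + l.sum)) _ hv s l
    fun _ _ h => Y.measurable_X_past h

lemma measurable_pathProd_future (hv : Measurable v) (s : ℝ≥0) (l : List ℝ≥0) :
    Measurable[futureSigma Y.X s] (pathProd Y.X v s l) :=
  @measurable_pathProd_of_forall _ _ _ _ (futureSigma Y.X s) _ hv s l
    fun _ h _ => Y.measurable_X_future h

lemma measurable_pathExp (hv : Measurable v) (l : List ℝ≥0) : Measurable (Y.pathExp v l) := by
  induction l with
  | nil => exact hv
  | cons d l ih => exact hv.mul (measurable_semigroup d ih)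

lemma abs_pathExp_le (hv1 : ∀ x, |v x| ≤ 1) (l : List ℝ≥0) (x : E) : |Y.pathExp v l x| ≤ 1 := by
  induction l generalizing x with
  | nil => exact hv1 _
  | cons d l ih =>
    rw [pathExp, abs_mul]
    exact mul_le_one₀ (hv1 _) (abs_nonneg _) (abs_semigroup_le d ih x)

/-- The first factor of the product is absorbed into `F`, which is then measurable for the enlarged
past. -/
lemma integral_mul_pathProd [IsProbabilityMeasure μ] (hv : Measurable v) (hv1 : ∀ x, |v x| ≤ 1)
    (s : ℝ≥0) (l : List ℝ≥0) {F : Ω → ℝ}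
    (hF : Measurable[pastSigma Y.X s] F) (hF1 : ∀ ω, |F ω| ≤ 1) :
    ∫ ω, F ω * pathProd Y.X v s l ω ∂(Y.lawFrom μ) =
      ∫ ω, F ω * Y.pathExp v l (Y.X s ω) ∂(Y.lawFrom μ) := by
  induction l generalizing s F with
  | nil => rfl
  | cons d l ih =>
    have hm : Measurable[pastSigma Y.X s] fun ω => F ω * v (Y.X s ω) :=
      Measurable.mul hF (hv.comp (Y.measurable_X_past le_rfl))
    have hb : ∀ ω, |F ω * v (Y.X s ω)| ≤ 1 := fun ω => by
      rw [abs_mul]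
      exact mul_le_one₀ (hF1 _) (abs_nonneg _) (hv1 _)
    have h1 := ih (s + d) (hm.mono (Y.pastSigma_mono (by simp)) le_rfl) hb
    have h2 := integral_mul_markov (μ := μ) s d hm hb (measurable_pathExp (Y := Y) hv l)
      (abs_pathExp_le hv1 l)
    simp only [pathProd, pathExp, ← mul_assoc]
    rw [h1, h2]

lemma integral_pathProd [IsProbabilityMeasure μ] (hμ : Y.IsInvariant μ) (hv : Measurable v)
    (hv1 : ∀ x, |v x| ≤ 1) (s : ℝ≥0) (l : List ℝ≥0) :
    ∫ ω, pathProd Y.X v s l ω ∂(Y.lawFrom μ) = ∫ x, Y.pathExp v l x ∂μ := by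
  have h := integral_mul_pathProd (μ := μ) (Y := Y) hv hv1 s l (F := fun _ => 1)
    measurable_const (by simp)
  simp only [one_mul] at h
  rw [h, integral_comp_X hμ s (measurable_pathExp hv l)]

/-- Expectations of functions of the past and the future in terms of the semigroup. -/
lemma integral_mul_pathProd_gap [IsProbabilityMeasure μ] (hv : Measurable v)
    (hv1 : ∀ x, |v x| ≤ 1) (s r : ℝ≥0) (l : List ℝ≥0) {F : Ω → ℝ}
    (hF : Measurable[pastSigma Y.X s] F) (hF1 : ∀ ω, |F ω| ≤ 1) :
    ∫ ω, F ω * pathProd Y.X v (s + r) l ω ∂(Y.lawFrom μ) =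
      ∫ ω, F ω * Y.semigroup r (Y.pathExp v l) (Y.X s ω) ∂(Y.lawFrom μ) := by
  rw [integral_mul_pathProd hv hv1 (s + r) l (hF.mono (Y.pastSigma_mono (by simp)) le_rfl) hF1,
    integral_mul_markov s r hF hF1 (measurable_pathExp hv l) (abs_pathExp_le hv1 l)]

lemma integral_sq_semigroup_sub_le [IsProbabilityMeasure μ] (hμ : Y.IsInvariant μ)
    {η : ℝ≥0 → ℝ≥0} (hη : Y.Decay μ η) (t : ℝ≥0) {f : E → ℝ} (hf : Measurable f)
    (hf1 : ∀ x, |f x| ≤ 1) :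
    ∫ x, (Y.semigroup t f x - ∫ y, f y ∂μ) ^ 2 ∂μ ≤ 4 * η t := by
  have h := hη.2 f hf ⟨1, hf1⟩ t
  rw [variance_eq_integral (measurable_semigroup t hf).aemeasurable,
    integral_semigroup hμ t hf hf1] at h
  refine h.trans ?_
  -- Centering at most doubles the sup norm; its square is the factor `4`.
  have h1 : ⨆ x, |f x - ∫ y, f y ∂μ| ≤ 2 := by
    refine Real.iSup_le (fun x => (abs_sub _ _).trans ?_) (by norm_num)
    linarith [hf1 x, abs_integral_le_of_abs_le (P := μ) hf1]
  have h0 : 0 ≤ ⨆ x, |f x - ∫ y, f y ∂μ| := Real.iSup_nonneg fun _ => abs_nonneg _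
  nlinarith [mul_le_mul h1 h1 h0 (by norm_num), (η t).coe_nonneg]

lemma integral_mul_semigroup_symm [IsProbabilityMeasure μ] (hs : Y.IsSymmetric μ) (t : ℝ≥0)
    {f g : E → ℝ} (hf : Measurable f) (hf1 : ∀ x, |f x| ≤ 1) (hg : Measurable g)
    (hg1 : ∀ x, |g x| ≤ 1) :
    ∫ x, f x * Y.semigroup t g x ∂μ = ∫ x, Y.semigroup t f x * g x ∂μ := by
  -- Reversibility is the exchangeability of the two-time law, checked on rectangles.
  have hsw : (μ ⊗ₘ Y.transition t).map Prod.swap = μ ⊗ₘ Y.transition t := by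
    refine Measure.ext_prod fun {A} {B} hA hB => ?_
    rw [Measure.map_apply measurable_swap (hA.prod hB), Set.preimage_swap_prod,
      Measure.compProd_apply_prod hA hB, Measure.compProd_apply_prod hB hA, hs t hB hA]
  have hm : Measurable fun p : E × E => f p.1 * g p.2 := by fun_prop
  have hm' : Measurable fun p : E × E => g p.1 * f p.2 := by fun_prop
  have hb : ∀ (f g : E → ℝ), (∀ x, |f x| ≤ 1) → (∀ x, |g x| ≤ 1) → ∀ p : E × E,
      |f p.1 * g p.2| ≤ 1 := fun f g hf1 hg1 p => by
    rw [abs_mul]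
    exact mul_le_one₀ (hf1 _) (abs_nonneg _) (hg1 _)
  have e1 : ∫ x, f x * Y.semigroup t g x ∂μ = ∫ p, f p.1 * g p.2 ∂(μ ⊗ₘ Y.transition t) := by
    rw [Measure.integral_compProd (integrable_of_abs_le hm 1 (hb f g hf1 hg1))]
    simp [semigroup, integral_const_mul]
  have e2 : ∫ x, g x * Y.semigroup t f x ∂μ = ∫ p, g p.1 * f p.2 ∂(μ ⊗ₘ Y.transition t) := by
    rw [Measure.integral_compProd (integrable_of_abs_le hm' 1 (hb g f hg1 hf1))]
    simp [semigroup, integral_const_mul]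
  simp only [mul_comm (Y.semigroup t f _)]
  rw [e1, e2, ← hsw, integral_map measurable_swap.aemeasurable (hsw ▸ hm.aestronglyMeasurable)]
  rw [hsw]
  simp [mul_comm]

/-- For a reversible process, the conditional expectation of a function of the past given the
present is explicit. -/
lemma exists_integral_pathProd_mul [IsProbabilityMeasure μ] (hμ : Y.IsInvariant μ)
    (hs : Y.IsSymmetric μ) (hv : Measurable v) (hv1 : ∀ x, |v x| ≤ 1) (s : ℝ≥0) (l : List ℝ≥0) :
    ∃ w : E → ℝ, Measurable w ∧ (∀ x, |w x| ≤ 1) ∧ ∀ f : E → ℝ, Measurable f →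
      (∀ x, |f x| ≤ 1) →
      ∫ ω, pathProd Y.X v s l ω * f (Y.X (s + l.sum) ω) ∂(Y.lawFrom μ) = ∫ x, w x * f x ∂μ := by
  -- Appending a last gap `d` turns `w` into `(P_d w) * v`: the Markov property moves to the
  -- previous time, and symmetry moves `P_d` from the future factor onto `w`.
  induction l using List.reverseRecOn with
  | nil =>
    refine ⟨v, hv, hv1, fun f hf hf1 => ?_⟩
    simpa [pathProd] using integral_comp_X hμ s (hv.mul hf)
  | append_singleton l d ih =>
    obtain ⟨w, hw, hw1, h⟩ := ih
    refine ⟨fun x => Y.semigroup d w x * v x, (measurable_semigroup d hw).mul hv, fun x => ?_,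
      fun f hf hf1 => ?_⟩
    · rw [abs_mul]
      exact mul_le_one₀ (abs_semigroup_le d hw1 x) (abs_nonneg _) (hv1 x)
    have hvf : ∀ x, |v x * f x| ≤ 1 := fun x => by
      rw [abs_mul]
      exact mul_le_one₀ (hv1 x) (abs_nonneg _) (hf1 x)
    have h1 := integral_mul_markov (μ := μ) (s + l.sum) d (measurable_pathProd_past (Y := Y) hv s l)
      (abs_pathProd_le hv1 s l) (hv.mul hf) hvf
    have h2 := h _ (measurable_semigroup d (hv.mul hf)) (abs_semigroup_le (Y := Y) d hvf)
    have h3 := integral_mul_semigroup_symm hs d hw hw1 (hv.mul hf) hvf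
    simp only [pathProd_append, pathProd, List.sum_append, List.sum_singleton, ← add_assoc,
      mul_assoc]
    exact h1.trans (h2.trans h3)

end MarkovProcess

/-! ### Correlation bounds for the three choices of `α` -/

/-- Makes the set defining `strongMixing` bounded, so that its `sSup` is a true supremum. -/
lemma abs_covariance_le_one {Ω : Type*} [MeasurableSpace Ω] {P : Measure Ω}
    [IsProbabilityMeasure P] {F G : Ω → ℝ} (hF : Measurable F) (hG : Measurable G)
    (hF1 : ∀ ω, F ω ∈ Set.Icc (0 : ℝ) 1) (hG1 : ∀ ω, G ω ∈ Set.Icc (0 : ℝ) 1) :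
    |covariance F G P| ≤ 1 := by
  have bF : ∀ ω, |F ω| ≤ 1 := fun ω => abs_le.2 ⟨by linarith [(hF1 ω).1], (hF1 ω).2⟩
  have bG : ∀ ω, |G ω| ≤ 1 := fun ω => abs_le.2 ⟨by linarith [(hG1 ω).1], (hG1 ω).2⟩
  have bFG : ∀ ω, |F ω * G ω| ≤ 1 := fun ω => by
    rw [abs_mul]
    exact mul_le_one₀ (bF ω) (abs_nonneg _) (bG ω)
  rw [covariance_eq_sub (MemLp.of_bound hF.aestronglyMeasurable 1 (ae_of_all _ bF))
    (MemLp.of_bound hG.aestronglyMeasurable 1 (ae_of_all _ bG))]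
  have h0 : 0 ≤ ∫ ω, F ω ∂P := integral_nonneg fun ω => (hF1 ω).1
  have h1 : 0 ≤ ∫ ω, G ω ∂P := integral_nonneg fun ω => (hG1 ω).1
  have h2 : 0 ≤ ∫ ω, (F * G) ω ∂P := integral_nonneg fun ω => mul_nonneg (hF1 ω).1 (hG1 ω).1
  have h3 := (abs_le.1 (abs_integral_le_of_abs_le (P := P) bF)).2
  have h4 := (abs_le.1 (abs_integral_le_of_abs_le (P := P) bG)).2
  have h5 : ∫ ω, (F * G) ω ∂P ≤ 1 := (abs_le.1 (abs_integral_le_of_abs_le (P := P) bFG)).2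
  rw [abs_le]
  constructor <;> nlinarith

lemma sq_integral_abs_le {Ω : Type*} [MeasurableSpace Ω] {P : Measure Ω}
    [IsProbabilityMeasure P] {F : Ω → ℝ} (hF : Measurable F) {c : ℝ} (hc : ∀ ω, |F ω| ≤ c) :
    (∫ ω, |F ω| ∂P) ^ 2 ≤ ∫ ω, F ω ^ 2 ∂P := by
  have hm : MemLp (fun ω => |F ω|) 2 P :=
    MemLp.of_bound hF.abs.aestronglyMeasurable c (ae_of_all _ fun ω => by simpa using hc ω)
  have h := variance_nonneg (fun ω => |F ω|) P
  rw [variance_eq_sub hm] at h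
  simp only [Pi.pow_apply, sq_abs] at h
  linarith

/-- The map `x ↦ (x + 1) / 2` sends `[-1, 1]` to `[0, 1]` and divides covariances by `4`. -/
lemma abs_integral_mul_sub_le_strongMixing {Ω E : Type*} [MeasurableSpace Ω] [MeasurableSpace E]
    (X : ℝ≥0 → Ω → E) (hX : ∀ t, Measurable (X t)) (P : Measure Ω) [IsProbabilityMeasure P]
    (s r : ℝ≥0) {F G : Ω → ℝ} (hF : Measurable[pastSigma X s] F)
    (hG : Measurable[futureSigma X (s + r)] G) (hF1 : ∀ ω, |F ω| ≤ 1) (hG1 : ∀ ω, |G ω| ≤ 1) :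
    |∫ ω, F ω * G ω ∂P - (∫ ω, F ω ∂P) * ∫ ω, G ω ∂P| ≤ 4 * strongMixing X P r := by
  have hp : ∀ s, pastSigma X s ≤ ‹MeasurableSpace Ω› := fun s =>
    iSup_le fun u => (hX u).comap_le
  have hf : ∀ s, futureSigma X s ≤ ‹MeasurableSpace Ω› := fun s =>
    iSup_le fun u => (hX u).comap_le
  have hFm : Measurable F := hF.mono (hp _) le_rfl
  have hGm : Measurable G := hG.mono (hf _) le_rfl
  have hFL : MemLp F 2 P := MemLp.of_bound hFm.aestronglyMeasurable 1 (ae_of_all _ hF1)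
  have hGL : MemLp G 2 P := MemLp.of_bound hGm.aestronglyMeasurable 1 (ae_of_all _ hG1)
  have hcov : covariance (fun ω => 2⁻¹ * F ω + 2⁻¹) (fun ω => 2⁻¹ * G ω + 2⁻¹) P =
      4⁻¹ * (∫ ω, F ω * G ω ∂P - (∫ ω, F ω ∂P) * ∫ ω, G ω ∂P) := by
    rw [covariance_add_const_left ((integrable_of_abs_le hFm 1 hF1).const_mul _),
      covariance_add_const_right ((integrable_of_abs_le hGm 1 hG1).const_mul _),
      covariance_const_mul_left, covariance_const_mul_right, covariance_eq_sub hFL hGL]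
    simp only [Pi.mul_apply]
    ring
  have hle : |covariance (fun ω => 2⁻¹ * F ω + 2⁻¹) (fun ω => 2⁻¹ * G ω + 2⁻¹) P| ≤
      strongMixing X P r := by
    refine le_csSup ⟨1, ?_⟩ ⟨s, _, _, (hF.const_mul _).add_const _, (hG.const_mul _).add_const _,
      fun ω => ?_, fun ω => ?_, rfl⟩
    · rintro _ ⟨s, F, G, hF, hG, hF1, hG1, rfl⟩
      exact abs_covariance_le_one (hF.mono (hp _) le_rfl) (hG.mono (hf _) le_rfl) hF1 hG1
    · constructor <;> linarith [(abs_le.1 (hF1 ω)).1, (abs_le.1 (hF1 ω)).2]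
    · constructor <;> linarith [(abs_le.1 (hG1 ω)).1, (abs_le.1 (hG1 ω)).2]
  rw [hcov, abs_mul, abs_of_pos (by norm_num : (0 : ℝ) < 4⁻¹)] at hle
  linarith

namespace MarkovProcess

variable {Ω E : Type*} [MeasurableSpace Ω] [MeasurableSpace E] {Y : MarkovProcess Ω E}
  {μ : Measure E} [IsProbabilityMeasure μ] {η : ℝ≥0 → ℝ≥0} {v : E → ℝ}

/-- The decay of the variance bounds the correlations of the past and the future. -/
lemma abs_integral_mul_pathProd_sub_le_sqrt (hμ : Y.IsInvariant μ) (hη : Y.Decay μ η)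
    (hv : Measurable v) (hv1 : ∀ x, |v x| ≤ 1) (s r : ℝ≥0) (l : List ℝ≥0) {F : Ω → ℝ}
    (hF : Measurable[pastSigma Y.X s] F) (hF1 : ∀ ω, |F ω| ≤ 1) :
    |∫ ω, F ω * pathProd Y.X v (s + r) l ω ∂(Y.lawFrom μ) -
        (∫ ω, F ω ∂(Y.lawFrom μ)) * ∫ ω, pathProd Y.X v (s + r) l ω ∂(Y.lawFrom μ)| ≤
      4 * √(η r) := by
  set P := Y.lawFrom μ
  set g := Y.pathExp v l with hg
  have hgm : Measurable g := measurable_pathExp hv l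
  have hg1 : ∀ x, |g x| ≤ 1 := abs_pathExp_le hv1 l
  set m := ∫ x, g x ∂μ with hm
  have hm1 : |m| ≤ 1 := abs_integral_le_of_abs_le hg1
  have hFm : Measurable F := hF.mono (Y.pastSigma_le s) le_rfl
  have hPm : Measurable (Y.semigroup r g) := measurable_semigroup r hgm
  have hP1 : ∀ x, |Y.semigroup r g x| ≤ 1 := abs_semigroup_le r hg1
  have hb : ∀ x, |Y.semigroup r g x - m| ≤ 2 := fun x =>
    (abs_sub _ _).trans (by linarith [hP1 x])
  rw [integral_mul_pathProd_gap hv hv1 s r l hF hF1, integral_pathProd hμ hv hv1, ← hg, ← hm,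
    ← integral_mul_const, ← integral_sub]
  · have h1 : |∫ ω, (F ω * Y.semigroup r g (Y.X s ω) - F ω * m) ∂P| ≤
        ∫ x, |Y.semigroup r g x - m| ∂μ := by
      rw [← integral_comp_X hμ s (hPm.sub_const m).abs]
      refine abs_integral_le_integral_abs.trans (integral_mono ?_ ?_ fun ω => ?_)
      · refine (integrable_of_abs_le ((hFm.mul (hPm.comp (Y.measurable_X s))).sub
          (hFm.mul_const m)) 2 fun ω => ?_).abs
        change |F ω * Y.semigroup r g (Y.X s ω) - F ω * m| ≤ 2
        rw [← mul_sub, abs_mul]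
        nlinarith [hF1 ω, hb (Y.X s ω), abs_nonneg (F ω),
          abs_nonneg (Y.semigroup r g (Y.X s ω) - m)]
      · exact integrable_of_abs_le ((hPm.sub_const m).abs.comp (Y.measurable_X s)) 2
          fun ω => by simpa using hb (Y.X s ω)
      · simp only [← mul_sub, abs_mul]
        exact mul_le_of_le_one_left (abs_nonneg _) (hF1 ω)
    have h2 := sq_integral_abs_le (P := μ) (hPm.sub_const m) hb
    have h3 := integral_sq_semigroup_sub_le hμ hη r hgm hg1
    have h4 : ∫ x, |Y.semigroup r g x - m| ∂μ ≤ √(4 * η r) := Real.le_sqrt_of_sq_le (h2.trans h3)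
    rw [Real.sqrt_mul (by norm_num), show (4 : ℝ) = 2 ^ 2 by norm_num,
      Real.sqrt_sq (by norm_num)] at h4
    linarith [Real.sqrt_nonneg (η r : ℝ)]
  · refine integrable_of_abs_le (hFm.mul (hPm.comp (Y.measurable_X s))) 1 fun ω => ?_
    rw [abs_mul]
    exact mul_le_one₀ (hF1 _) (abs_nonneg _) (hP1 _)
  · exact (integrable_of_abs_le hFm 1 hF1).mul_const m

/-- For a reversible process, the decay of the variance up to half of the gap can be used
twice. -/
lemma abs_integral_pathProd_mul_sub_le_half (hμ : Y.IsInvariant μ) (hs : Y.IsSymmetric μ)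
    (hη : Y.Decay μ η) (hv : Measurable v) (hv1 : ∀ x, |v x| ≤ 1) (s r : ℝ≥0)
    (l₁ l₂ : List ℝ≥0) :
    |∫ ω, pathProd Y.X v s l₁ ω * pathProd Y.X v (s + l₁.sum + r) l₂ ω ∂(Y.lawFrom μ) -
        (∫ ω, pathProd Y.X v s l₁ ω ∂(Y.lawFrom μ)) *
          ∫ ω, pathProd Y.X v (s + l₁.sum + r) l₂ ω ∂(Y.lawFrom μ)| ≤
      4 * η (r / 2) := by
  obtain ⟨w, hw, hw1, h⟩ := exists_integral_pathProd_mul hμ hs hv hv1 s l₁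
  set g := Y.pathExp v l₂ with hg
  have hgm : Measurable g := measurable_pathExp hv l₂
  have hg1 : ∀ x, |g x| ≤ 1 := abs_pathExp_le hv1 l₂
  have hF : ∫ ω, pathProd Y.X v s l₁ ω ∂(Y.lawFrom μ) = ∫ x, w x ∂μ := by
    simpa using h (fun _ => 1) measurable_const (by simp)
  rw [integral_mul_pathProd_gap hv hv1 _ r l₂ (measurable_pathProd_past hv s l₁)
    (abs_pathProd_le hv1 s l₁), integral_pathProd hμ hv hv1 _ l₂, hF, ← hg,
    h _ (measurable_semigroup r hgm) (abs_semigroup_le r hg1)]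
  -- Half of the gap is given to each of `w` and `g`, so the covariance pairs two functions that
  -- have both been smoothed.
  have hr : ∀ x, Y.semigroup r g x = Y.semigroup (r / 2) (Y.semigroup (r / 2) g) x := fun x => by
    rw [← semigroup_add _ _ hgm hg1, add_halves]
  simp only [hr]
  rw [integral_mul_semigroup_symm hs _ hw hw1 (measurable_semigroup _ hgm)
    (abs_semigroup_le _ hg1)]
  have i1 := integral_semigroup hμ (r / 2) hw hw1
  have i2 := integral_semigroup hμ (r / 2) hgm hg1
  have v1 := integral_sq_semigroup_sub_le hμ hη (r / 2) hw hw1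
  have v2 := integral_sq_semigroup_sub_le hμ hη (r / 2) hgm hg1
  have m1 : Measurable (Y.semigroup (r / 2) w) := measurable_semigroup _ hw
  have m2 : Measurable (Y.semigroup (r / 2) g) := measurable_semigroup _ hgm
  have b1 : ∀ x, |Y.semigroup (r / 2) w x| ≤ 1 := abs_semigroup_le _ hw1
  have b2 : ∀ x, |Y.semigroup (r / 2) g x| ≤ 1 := abs_semigroup_le _ hg1
  set a := Y.semigroup (r / 2) w
  set b := Y.semigroup (r / 2) g
  have L1 : MemLp a 2 μ := MemLp.of_bound m1.aestronglyMeasurable 1 (ae_of_all _ b1)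
  have L2 : MemLp b 2 μ := MemLp.of_bound m2.aestronglyMeasurable 1 (ae_of_all _ b2)
  have hc := covariance_eq_sub L1 L2
  simp only [Pi.mul_apply] at hc
  rw [← i1] at v1
  rw [← i2] at v2
  rw [← i1, ← i2]
  rw [← hc, covariance]
  have c1 : Integrable (fun x => (a x - ∫ y, a y ∂μ) ^ 2) μ :=
    (L1.sub (memLp_const _)).integrable_sq
  have c2 : Integrable (fun x => (b x - ∫ y, b y ∂μ) ^ 2) μ :=
    (L2.sub (memLp_const _)).integrable_sq
  calc |∫ x, (a x - ∫ y, a y ∂μ) * (b x - ∫ y, b y ∂μ) ∂μ|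
      ≤ ∫ x, |(a x - ∫ y, a y ∂μ) * (b x - ∫ y, b y ∂μ)| ∂μ := abs_integral_le_integral_abs
    _ ≤ ∫ x, (2⁻¹ * (a x - ∫ y, a y ∂μ) ^ 2 + 2⁻¹ * (b x - ∫ y, b y ∂μ) ^ 2) ∂μ := by
        refine integral_mono_of_nonneg (ae_of_all _ fun _ => abs_nonneg _)
          ((c1.const_mul _).add (c2.const_mul _)) (ae_of_all _ fun x => ?_)
        simp only [abs_mul]
        nlinarith [sq_nonneg (|a x - ∫ y, a y ∂μ| - |b x - ∫ y, b y ∂μ|),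
          sq_abs (a x - ∫ y, a y ∂μ), sq_abs (b x - ∫ y, b y ∂μ)]
    _ ≤ 4 * η (r / 2) := by
        rw [integral_add (c1.const_mul _) (c2.const_mul _), integral_const_mul,
          integral_const_mul]
        linarith

lemma abs_integral_pathProd_mul_sub_le (hμ : Y.IsInvariant μ) (hη : Y.Decay μ η)
    {α : ℝ≥0 → ℝ}
    (hα : α = strongMixing Y.X (Y.lawFrom μ) ∨ α = (fun r => √(η r)) ∨
      (Y.IsSymmetric μ ∧ α = fun r => (η (r / 2) : ℝ)))
    (hv : Measurable v) (hv1 : ∀ x, |v x| ≤ 1) (s r : ℝ≥0) (l₁ l₂ : List ℝ≥0) :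
    |∫ ω, pathProd Y.X v s l₁ ω * pathProd Y.X v (s + l₁.sum + r) l₂ ω ∂(Y.lawFrom μ) -
        (∫ ω, pathProd Y.X v s l₁ ω ∂(Y.lawFrom μ)) *
          ∫ ω, pathProd Y.X v (s + l₁.sum + r) l₂ ω ∂(Y.lawFrom μ)| ≤ 4 * α r := by
  rcases hα with rfl | rfl | ⟨hs, rfl⟩
  · exact abs_integral_mul_sub_le_strongMixing Y.X Y.measurable_X _ _ _
      (measurable_pathProd_past hv s l₁) (measurable_pathProd_future hv _ l₂)
      (abs_pathProd_le hv1 _ _) (abs_pathProd_le hv1 _ _)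
  · exact abs_integral_mul_pathProd_sub_le_sqrt hμ hη hv hv1 _ r l₂
      (measurable_pathProd_past hv s l₁) (abs_pathProd_le hv1 _ _)
  · exact abs_integral_pathProd_mul_sub_le_half hμ hs hη hv hv1 s r l₁ l₂

end MarkovProcess

/-! ### Moments of sums along a grid -/

section moments

variable {Ω E : Type*} {X : ℝ≥0 → Ω → E} {v : E → ℝ}

lemma prod_map_runningSums (u h : ℝ≥0) (c : ℕ) (d : List ℕ) (ω : Ω) :
    ((c :: runningSums c d).map fun i : ℕ => v (X (u + i * h) ω)).prod =
      pathProd X v (u + c * h) (d.map fun i : ℕ => (i : ℝ≥0) * h) ω := by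
  induction d generalizing c with
  | nil => simp [runningSums, pathProd]
  | cons i d ih =>
    have := ih (c + i)
    rw [runningSums, List.map_cons, List.prod_cons, this]
    simp [pathProd, add_mul, add_assoc]

variable [MeasurableSpace Ω] [MeasurableSpace E]

/-- The moments of the sums of a bounded centered stationary sequence with polynomially decaying
correlations. -/
lemma exists_integral_pow_sum_le {k : ℕ} (hk : 2 ≤ k) {D : ℝ} (hD : 0 ≤ D) :
    ∃ C : ℝ, 0 ≤ C ∧ ∀ (Ω : Type*) (E : Type*) [MeasurableSpace Ω] [MeasurableSpace E]
      (P : Measure Ω) [IsProbabilityMeasure P] (X : ℝ≥0 → Ω → E), (∀ t, Measurable (X t)) →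
      ∀ v : E → ℝ, Measurable v → (∀ x, |v x| ≤ 1) → (∀ s, ∫ ω, v (X s ω) ∂P = 0) →
      (∀ s s' l, ∫ ω, pathProd X v s l ω ∂P = ∫ ω, pathProd X v s' l ω ∂P) →
      ∀ (h : ℝ≥0) (κ : ℝ), 0 ≤ κ → κ ≤ 1 →
      (∀ (s : ℝ≥0) (r : ℕ) (l₁ l₂ : List ℝ≥0),
        |∫ ω, pathProd X v s l₁ ω * pathProd X v (s + l₁.sum + r * h) l₂ ω ∂P -
          (∫ ω, pathProd X v s l₁ ω ∂P) * ∫ ω, pathProd X v (s + l₁.sum + r * h) l₂ ω ∂P| ≤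
        D * κ / ((r : ℝ) + 1) ^ k) →
      ∀ (u : ℝ≥0) (N : ℕ),
        ∫ ω, (∑ j ∈ Finset.range N, v (X (u + j * h) ω)) ^ (2 * k) ∂P ≤ C * κ * (N : ℝ) ^ k := by
  obtain ⟨C, hC0, hC⟩ := exists_gridSum_abs_le hk hD (2 * k - 1) (by omega)
  refine ⟨(2 * k).factorial * C, by positivity, ?_⟩
  intro Ω E _ _ P _ X hX v hv hv1 hv0 hst h κ hκ0 hκ1 hmix u N
  let e : List ℕ → ℝ := fun l => ∫ ω, (l.map fun i : ℕ => v (X (u + i * h) ω)).prod ∂P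
  let φ : List ℕ → ℝ := fun d => ∫ ω, pathProd X v 0 (d.map fun i : ℕ => (i : ℝ≥0) * h) ω ∂P
  have heφ : ∀ c d, e (c :: runningSums c d) = φ d := fun c d => by
    simp only [e, φ, prod_map_runningSums]
    exact hst _ _ _
  have hφ : ∀ l₁ r l₂, |φ (l₁ ++ r :: l₂) - φ l₁ * φ l₂| ≤ D * κ / ((r : ℝ) + 1) ^ k := by
    intro l₁ r l₂
    have := hmix 0 r (l₁.map fun i : ℕ => (i : ℝ≥0) * h) (l₂.map fun i : ℕ => (i : ℝ≥0) * h)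
    rw [hst (0 + _ + _) 0] at this
    simpa only [φ, List.map_append, List.map_cons, pathProd_append] using this
  have hgrid := hC N κ φ (fun r => D * κ / ((r : ℝ) + 1) ^ k) hκ0 hκ1 (fun r => by positivity)
    (fun r => le_rfl) (by simpa [φ, pathProd] using hv0 0) hφ
  have hm : ∀ i : ℕ, Measurable fun ω => v (X (u + i * h) ω) := fun i => hv.comp (hX _)
  have hexp : ∫ ω, (∑ j ∈ Finset.range N, v (X (u + j * h) ω)) ^ (2 * k) ∂P =
      ∑ f : Fin (2 * k) → Fin N, e (List.ofFn fun i => (f i : ℕ)) := by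
    have h1 : ∀ ω, (∑ j ∈ Finset.range N, v (X (u + j * h) ω)) ^ (2 * k) =
        ∑ f : Fin (2 * k) → Fin N, ∏ i, v (X (u + (f i : ℕ) * h) ω) := fun ω => by
      rw [Finset.sum_range fun j : ℕ => v (X (u + j * h) ω), Fintype.sum_pow]
    simp only [h1]
    rw [integral_finsetSum]
    · refine Finset.sum_congr rfl fun f _ => integral_congr_ae (ae_of_all _ fun ω => ?_)
      simp [List.map_ofFn, List.prod_ofFn]
    · intro f _
      refine integrable_of_abs_le (Finset.measurable_prod _ fun i _ => hm _) 1 fun ω => ?_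
      rw [Finset.abs_prod]
      exact Finset.prod_le_one (fun _ _ => abs_nonneg _) fun _ _ => hv1 _
  rw [hexp]
  have h2 : ∑ f : Fin (2 * k) → Fin N, |e (List.ofFn fun i => (f i : ℕ))| ≤
      (2 * k).factorial * gridSum N (2 * k) fun d => |e (runningSums 0 d)| :=
    sum_tuples_le_gridSum (2 * k) (g := fun l => |e l|) (fun _ => abs_nonneg _)
      fun l l' hl => by simp only [e, fun ω => (hl.map fun i : ℕ => v (X (u + i * h) ω)).prod_eq]
  -- The first increment is the position of the first point; by stationarity it does not affect the
  -- expectation and contributes `N`.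
  have h3 : gridSum N (2 * k) (fun d => |e (runningSums 0 d)|) =
      N * gridSum N (2 * k - 1) (fun d => |φ d|) := by
    conv_lhs => rw [show 2 * k = (2 * k - 1) + 1 by omega]
    simp [gridSum, runningSums, heφ]
  have h4 : (N : ℝ) * √N ^ (2 * k - 1 - 1) = (N : ℝ) ^ k := by
    rw [show 2 * k - 1 - 1 = 2 * (k - 1) by omega, pow_mul, Real.sq_sqrt (by positivity),
      ← pow_succ']
    congr 1
    omega
  calc ∑ f : Fin (2 * k) → Fin N, e (List.ofFn fun i => (f i : ℕ))
      ≤ ∑ f : Fin (2 * k) → Fin N, |e (List.ofFn fun i => (f i : ℕ))| :=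
        Finset.sum_le_sum fun _ _ => le_abs_self _
    _ ≤ (2 * k).factorial * (N * (C * κ * √N ^ (2 * k - 1 - 1))) := by
        refine h2.trans ?_
        rw [h3]
        gcongr
    _ = (2 * k).factorial * C * κ * (N * √N ^ (2 * k - 1 - 1)) := by ring
    _ = _ := by rw [h4]

end moments

/-! ### From grid sums to time integrals -/

section timeIntegral

variable {Ω E : Type*} [MeasurableSpace Ω] [MeasurableSpace E] {X : ℝ≥0 → Ω → E} {v : E → ℝ}

/-- Cutting into cells of length `h` and rescaling each to `[0, 1]` writes the integral as an
average of sums along shifted grids. -/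
lemma intervalIntegral_eq_mul_integral_sum {f : ℝ → ℝ} (hf : Measurable f) {c : ℝ}
    (hc : ∀ x, |f x| ≤ c) (h : ℝ) (N : ℕ) :
    ∫ s in (0 : ℝ)..N * h, f s =
      h * ∫ x in (0 : ℝ)..1, ∑ j ∈ Finset.range N, f (h * x + j * h) := by
  have hi : ∀ g : ℝ → ℝ, Measurable g → (∀ x, |g x| ≤ c) → ∀ a b : ℝ,
      IntervalIntegrable g volume a b := fun g hg hgc a b =>
    (intervalIntegrable_const (c := c)).mono_fun hg.aestronglyMeasurable
      (ae_of_all _ fun x => by simpa using (hgc x).trans (le_abs_self c))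
  rw [intervalIntegral.integral_finsetSum fun j _ => hi _ (by fun_prop) (fun x => hc _) _ _,
    Finset.mul_sum]
  have h1 := intervalIntegral.sum_integral_adjacent_intervals (f := f) (μ := volume) (n := N)
    (a := fun j : ℕ => (j : ℝ) * h) fun j _ => hi f hf hc _ _
  simp only [Nat.cast_zero, zero_mul] at h1
  rw [← h1]
  refine Finset.sum_congr rfl fun j _ => ?_
  rw [intervalIntegral.mul_integral_comp_mul_add]
  congr 1 <;> push_cast <;> ring

lemma measurable_comp_toNNReal (hX : Measurable fun p : ℝ≥0 × Ω => X p.1 p.2)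
    (hv : Measurable v) (ω : Ω) : Measurable fun s : ℝ => v (X s.toNNReal ω) :=
  hv.comp (hX.comp (measurable_real_toNNReal.prodMk measurable_const))

lemma measurable_timeIntegral (hX : Measurable fun p : ℝ≥0 × Ω => X p.1 p.2)
    (hv : Measurable v) (a b : ℝ) : Measurable fun ω => ∫ s in a..b, v (X s.toNNReal ω) := by
  have h : Measurable fun p : Ω × ℝ => v (X p.2.toNNReal p.1) :=
    hv.comp (hX.comp (measurable_snd.real_toNNReal.prodMk measurable_fst))
  simp only [intervalIntegral]
  exact (h.stronglyMeasurable.integral_prod_right' (ν := volume.restrict (Set.Ioc a b))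
    ).measurable.sub (h.stronglyMeasurable.integral_prod_right'
      (ν := volume.restrict (Set.Ioc b a))).measurable

/-- By Jensen's inequality, moments of a time integral are controlled by the moments of the sums
along a grid. -/
lemma integral_pow_timeIntegral_le {P : Measure Ω} [IsProbabilityMeasure P]
    (hX : Measurable fun p : ℝ≥0 × Ω => X p.1 p.2) (hv : Measurable v) (hv1 : ∀ x, |v x| ≤ 1)
    (h : ℝ≥0) (N n : ℕ) {B : ℝ}
    (hB : ∀ u : ℝ≥0, ∫ ω, (∑ j ∈ Finset.range N, v (X (u + j * h) ω)) ^ (2 * n) ∂P ≤ B) :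
    ∫ ω, (∫ s in (0 : ℝ)..N * h, v (X s.toNNReal ω)) ^ (2 * n) ∂P ≤ (h : ℝ) ^ (2 * n) * B := by
  let S : Ω → ℝ → ℝ := fun ω x =>
    ∑ j ∈ Finset.range N, v (X ((h * x).toNNReal + j * h) ω)
  let ν : Measure ℝ := volume.restrict (Set.Ioc 0 1)
  have : IsProbabilityMeasure ν := ⟨by simp [ν]⟩
  have hSm : Measurable fun p : Ω × ℝ => S p.1 p.2 :=
    Finset.measurable_sum _ fun j _ => hv.comp (hX.comp
      (((measurable_snd.const_mul _).real_toNNReal.add_const _).prodMk measurable_fst))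
  have hSb : ∀ ω x, |S ω x| ≤ N := fun ω x => by
    refine (Finset.abs_sum_le_sum_abs _ _).trans ?_
    simpa using Finset.sum_le_sum fun j (_ : j ∈ Finset.range N) =>
      hv1 (X ((h * x).toNNReal + j * h) ω)
  have hSb' : ∀ p : Ω × ℝ, |S p.1 p.2 ^ (2 * n)| ≤ (N : ℝ) ^ (2 * n) := fun p => by
    rw [abs_pow]
    exact pow_le_pow_left₀ (abs_nonneg _) (hSb _ _) _
  have hint : Integrable (Function.uncurry fun ω x => S ω x ^ (2 * n)) (P.prod ν) :=
    integrable_of_abs_le (hSm.pow_const _) _ hSb'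
  have hZ : ∀ ω, (∫ s in (0 : ℝ)..N * h, v (X s.toNNReal ω)) = h * ∫ x, S ω x ∂ν := by
    intro ω
    rw [intervalIntegral_eq_mul_integral_sum (measurable_comp_toNNReal hX hv ω)
      (fun s => hv1 _) h N, intervalIntegral.integral_of_le zero_le_one]
    congr 1
    refine setIntegral_congr_fun measurableSet_Ioc fun x hx => ?_
    refine Finset.sum_congr rfl fun j _ => ?_
    have hx0 : 0 ≤ (h : ℝ) * x := mul_nonneg h.coe_nonneg hx.1.le
    rw [Real.toNNReal_add hx0 (by positivity)]
    congr 3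
    ext
    simp only [Real.coe_toNNReal', NNReal.coe_mul, NNReal.coe_natCast, sup_eq_left]
    positivity
  have hJ : ∀ ω, (∫ x, S ω x ∂ν) ^ (2 * n) ≤ ∫ x, S ω x ^ (2 * n) ∂ν := fun ω => by
    have hm : Measurable (S ω) := hSm.comp (measurable_const.prodMk measurable_id)
    exact (even_two_mul n).convexOn_pow.map_integral_le (continuous_pow _).continuousOn
      isClosed_univ (by simp) (integrable_of_abs_le hm _ (hSb ω))
      (integrable_of_abs_le (hm.pow_const _) _ fun x => hSb' (ω, x))
  have hSwap : ∫ ω, ∫ x, S ω x ^ (2 * n) ∂ν ∂P ≤ B := by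
    rw [integral_integral_swap hint]
    have hi : Integrable (fun x => ∫ ω, S ω x ^ (2 * n) ∂P) ν := hint.integral_prod_right
    calc ∫ x, ∫ ω, S ω x ^ (2 * n) ∂P ∂ν ≤ ∫ _, B ∂ν :=
          integral_mono hi (integrable_const _) fun x => hB _
      _ = B := by simp
  simp only [hZ, mul_pow]
  rw [integral_const_mul]
  gcongr
  refine le_trans ?_ hSwap
  exact integral_mono_of_nonneg (ae_of_all _ fun ω => (even_two_mul n).pow_nonneg _)
    hint.integral_prod_left (ae_of_all _ hJ)

end timeIntegral

/-! ### Choice of the grid and moments of the time integral -/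

/-- The grid on which the mixing coefficients become of order one. -/
lemma exists_grid {k : ℕ} (hk : k ≠ 0) {M t : ℝ} (ht : 1 ≤ t) (hMt : M ≤ t ^ k) :
    ∃ (ℓ : ℝ) (h : ℝ≥0) (N : ℕ), 1 ≤ ℓ ∧ min 1 M * ℓ ^ k = M ∧ ℓ ≤ h ∧ h ≤ 2 * ℓ ∧
      N * (h : ℝ) = t := by
  set ℓ : ℝ := (max 1 M) ^ ((k : ℝ)⁻¹) with hℓ
  have hmax : (1 : ℝ) ≤ max 1 M := le_max_left _ _
  have hℓk : ℓ ^ k = max 1 M := Real.rpow_inv_natCast_pow (by positivity) hk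
  have hℓ1 : 1 ≤ ℓ := Real.one_le_rpow hmax (by positivity)
  have hℓt : ℓ ≤ t := by
    refine (pow_le_pow_iff_left₀ (by positivity) (by positivity) hk).1 ?_
    rw [hℓk]
    exact max_le (one_le_pow₀ ht) hMt
  have hq : 1 ≤ t / ℓ := (one_le_div (by positivity)).2 hℓt
  have hN : 1 ≤ ⌊t / ℓ⌋₊ := Nat.le_floor (by simpa using hq)
  have hN' : (1 : ℝ) ≤ ⌊t / ℓ⌋₊ := by exact_mod_cast hN
  have hN1 : (⌊t / ℓ⌋₊ : ℝ) ≤ t / ℓ := Nat.floor_le (by positivity)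
  have hN2 : t / ℓ < ⌊t / ℓ⌋₊ + 1 := Nat.lt_floor_add_one _
  rw [le_div_iff₀ (by positivity)] at hN1
  rw [div_lt_iff₀ (by positivity)] at hN2
  -- Rounding `t / ℓ` down makes `N * h = t` exact; as `N ≥ 1`, `t < ℓ * (N + 1) ≤ 2 * ℓ * N`.
  refine ⟨ℓ, ⟨t / ⌊t / ℓ⌋₊, by positivity⟩, ⌊t / ℓ⌋₊, hℓ1, ?_, ?_, ?_, ?_⟩
  · rw [hℓk, min_mul_max, one_mul]
  · change ℓ ≤ t / ⌊t / ℓ⌋₊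
    rw [le_div_iff₀ (by positivity)]
    linarith
  · change t / ⌊t / ℓ⌋₊ ≤ 2 * ℓ
    rw [div_le_iff₀ (by positivity)]
    nlinarith
  · change (⌊t / ℓ⌋₊ : ℝ) * (t / ⌊t / ℓ⌋₊) = t
    field_simp

namespace MarkovProcess

/-- The even moments of the centered time integrals. -/
lemma exists_integral_pow_timeIntegral_le {k : ℕ} (hk : 2 ≤ k) :
    ∃ C : ℝ, 0 ≤ C ∧ ∀ (Ω : Type*) (E : Type*) [MeasurableSpace Ω] [MeasurableSpace E]
      (Y : MarkovProcess Ω E) (μ : Measure E) [IsProbabilityMeasure μ], Y.IsInvariant μ →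
      ∀ η : ℝ≥0 → ℝ≥0, Y.Decay μ η → ∀ α : ℝ≥0 → ℝ,
      (α = strongMixing Y.X (Y.lawFrom μ) ∨ α = (fun r => √(η r)) ∨
        (Y.IsSymmetric μ ∧ α = fun r => (η (r / 2) : ℝ))) →
      ∀ M : ℝ, 0 ≤ M → (∀ r : ℝ≥0, (1 + (r : ℝ)) ^ k * α r ≤ M) →
      ∀ v : E → ℝ, Measurable v → (∀ x, |v x| ≤ 1) → ∫ x, v x ∂μ = 0 →
      ∀ t : ℝ, 1 ≤ t → M ≤ t ^ k →
        ∫ ω, (∫ s in (0 : ℝ)..t, v (Y.X s.toNNReal ω)) ^ (2 * k) ∂(Y.lawFrom μ) ≤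
          C * M * t ^ k := by
  obtain ⟨C, hC0, hC⟩ := exists_integral_pow_sum_le hk (D := 4 * 2 ^ k) (by positivity)
  refine ⟨2 ^ k * C, by positivity, ?_⟩
  intro Ω E _ _ Y μ _ hμ η hη α hα M hM hαM v hv hv1 hv0 t ht hMt
  obtain ⟨ℓ, h, N, hℓ1, hκ, hℓh, hhℓ, hNh⟩ := exists_grid (by omega) ht hMt
  have hκ0 : 0 ≤ min 1 M := le_min zero_le_one hM
  have hst : ∀ s s' l, ∫ ω, pathProd Y.X v s l ω ∂(Y.lawFrom μ) =
      ∫ ω, pathProd Y.X v s' l ω ∂(Y.lawFrom μ) := fun s s' l => by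
    rw [integral_pathProd hμ hv hv1, integral_pathProd hμ hv hv1]
  have hmix : ∀ (s : ℝ≥0) (r : ℕ) (l₁ l₂ : List ℝ≥0),
      |∫ ω, pathProd Y.X v s l₁ ω * pathProd Y.X v (s + l₁.sum + r * h) l₂ ω ∂(Y.lawFrom μ) -
        (∫ ω, pathProd Y.X v s l₁ ω ∂(Y.lawFrom μ)) *
          ∫ ω, pathProd Y.X v (s + l₁.sum + r * h) l₂ ω ∂(Y.lawFrom μ)| ≤
      4 * 2 ^ k * min 1 M / ((r : ℝ) + 1) ^ k := by
    intro s r l₁ l₂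
    have h1 := abs_integral_pathProd_mul_sub_le hμ hη hα hv hv1 s (r * h) l₁ l₂
    rw [le_div_iff₀ (by positivity)]
    -- At gap `0` the factor `min 1 M` needs two bounds: the trivial one by `2`, and `4 * α 0 ≤ 4 *
    -- M`.
    rcases Nat.eq_zero_or_pos r with rfl | hr
    · have h0 := hαM 0
      simp only [NNReal.coe_zero, add_zero, one_pow, one_mul] at h0
      simp only [Nat.cast_zero, zero_mul, zero_add, one_pow, mul_one] at h1 ⊢
      have b1 := abs_integral_le_of_abs_le (P := Y.lawFrom μ) (abs_pathProd_le hv1 s l₁ (X := Y.X))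
      have b2 := abs_integral_le_of_abs_le (P := Y.lawFrom μ)
        (abs_pathProd_le hv1 (s + l₁.sum + 0) l₂ (X := Y.X))
      have b3 : |∫ ω, pathProd Y.X v s l₁ ω * pathProd Y.X v (s + l₁.sum + 0) l₂ ω
          ∂(Y.lawFrom μ)| ≤ 1 := abs_integral_le_of_abs_le fun ω => by
        rw [abs_mul]
        exact mul_le_one₀ (abs_pathProd_le hv1 _ _ _) (abs_nonneg _) (abs_pathProd_le hv1 _ _ _)
      have b4 := mul_le_one₀ b1 (abs_nonneg _) b2
      rw [← abs_mul] at b4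
      have b5 : (1 : ℝ) ≤ 2 ^ k := one_le_pow₀ (by norm_num)
      have b6 : 4 * min 1 M ≤ 4 * 2 ^ k * min 1 M := by nlinarith
      refine le_trans ?_ b6
      rw [mul_min_of_nonneg _ _ (by norm_num : (0 : ℝ) ≤ 4)]
      exact le_min ((abs_sub _ _).trans (by linarith)) (h1.trans (by linarith))
    · have hr1 : (1 : ℝ) ≤ r := by exact_mod_cast hr
      have h2 := hαM (r * h)
      push_cast at h2
      -- Uses `r + 1 ≤ 2 * r` and `ℓ ≤ h`; its `k`-th power is the source of `2 ^ k` in `D`.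
      have h3 : ℓ * ((r : ℝ) + 1) ≤ 2 * (1 + r * h) := by nlinarith
      have h4 : (ℓ * ((r : ℝ) + 1)) ^ k ≤ (2 * (1 + r * h)) ^ k :=
        pow_le_pow_left₀ (by positivity) h3 k
      rw [mul_pow, mul_pow] at h4
      have hα0 : 0 ≤ α (r * h) := by linarith [(abs_nonneg _).trans h1]
      have hℓk : 0 < ℓ ^ k := by positivity
      refine (mul_le_mul_of_nonneg_right h1 (by positivity)).trans ?_
      refine le_of_mul_le_mul_right ?_ hℓk
      calc 4 * α (r * h) * ((r : ℝ) + 1) ^ k * ℓ ^ k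
          = 4 * α (r * h) * (ℓ ^ k * ((r : ℝ) + 1) ^ k) := by ring
        _ ≤ 4 * α (r * h) * (2 ^ k * (1 + r * h) ^ k) := by gcongr
        _ = 4 * 2 ^ k * ((1 + r * h) ^ k * α (r * h)) := by ring
        _ ≤ 4 * 2 ^ k * M := by gcongr
        _ = 4 * 2 ^ k * (min 1 M * ℓ ^ k) := by rw [hκ]
        _ = _ := by ring
  have hB := hC Ω E (Y.lawFrom μ) Y.X Y.measurable_X v hv hv1
    (fun s => (integral_comp_X hμ s hv).trans hv0) hst h (min 1 M) hκ0 (min_le_left _ _) hmix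
  have hZ := integral_pow_timeIntegral_le (P := Y.lawFrom μ) Y.measurable_uncurry hv hv1 h N k
    fun u => hB u N
  rw [hNh] at hZ
  refine hZ.trans ?_
  calc (h : ℝ) ^ (2 * k) * (C * min 1 M * (N : ℝ) ^ k)
      = C * min 1 M * (h : ℝ) ^ k * (N * h) ^ k := by rw [two_mul, pow_add, mul_pow]; ring
    _ = C * min 1 M * (h : ℝ) ^ k * t ^ k := by rw [hNh]
    _ ≤ C * min 1 M * (2 * ℓ) ^ k * t ^ k := by gcongr
    _ = 2 ^ k * C * (min 1 M * ℓ ^ k) * t ^ k := by rw [mul_pow]; ring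
    _ = _ := by rw [hκ]

end MarkovProcess

/-! ### The deviation inequality -/

theorem mainTheorem6 (k : ℕ) (hk : 2 ≤ k) :
    ∃ C : ℝ, 0 < C ∧
      ∀ (Ω : Type*) (E : Type*) [MeasurableSpace Ω]
        [TopologicalSpace E] [PolishSpace E] [MeasurableSpace E] [BorelSpace E]
        (Y : MarkovProcess Ω E) (μ : Measure E) [IsProbabilityMeasure μ],
        Y.IsInvariant μ →
        ∀ η : ℝ≥0 → ℝ≥0, Y.Decay μ η →
        ∀ α : ℝ≥0 → ℝ,
          (α = strongMixing Y.X (Y.lawFrom μ) ∨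
            α = (fun r => Real.sqrt (η r)) ∨
            (Y.IsSymmetric μ ∧ α = fun r => (η (r / 2) : ℝ))) →
          FiniteMixingMoment k α →
          ∀ V : E → ℝ, Measurable V → IsLUB (Set.range fun x => |V x|) 1 →
          ∀ R t : ℝ, 0 < R → R ≤ 1 → 0 < t → t * (1 - R) < ⌊t⌋₊ →
            (Y.lawFrom μ).real
                {ω | R ≤ 1 / t * (∫ s in (0 : ℝ)..t, V (Y.X s.toNNReal ω)) - ∫ x, V x ∂μ}
              ≤ C * mixingMoment k α / (t ^ k * (R - (1 - ⌊t⌋₊ / t)) ^ (2 * k)) := by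
  obtain ⟨C, hC0, hC⟩ := MarkovProcess.exists_integral_pow_timeIntegral_le hk
  -- `2 ^ (2 * k)` undoes the halving of `V - m` below; the `+ 1` covers the trivial case and
  -- ensures positivity.
  refine ⟨2 ^ (2 * k) * C + 1, by positivity, ?_⟩
  intro Ω E _ _ _ _ _ Y μ _ hμ η hη α hα hfin V hV hlub R t hR0 hR1 ht0 htR
  have hV1 : ∀ x, |V x| ≤ 1 := fun x => hlub.1 ⟨x, rfl⟩
  set M := mixingMoment k α with hMdef
  have hαM : ∀ r : ℝ≥0, (1 + (r : ℝ)) ^ k * α r ≤ M := fun r => le_ciSup hfin r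
  have hα0 : 0 ≤ α 0 := by
    have := MarkovProcess.abs_integral_pathProd_mul_sub_le hμ hη hα hV hV1 0 0 [] []
    linarith [(abs_nonneg _).trans this]
  have hM0 : 0 ≤ M := by
    have := hαM 0
    simp only [NNReal.coe_zero, add_zero, one_pow, one_mul] at this
    linarith
  -- Since `R ≤ 1`, the condition `t * (1 - R) < [t]` forces `t ≥ 1`.
  have hfl : (0 : ℝ) < ⌊t⌋₊ := lt_of_le_of_lt (mul_nonneg ht0.le (by linarith)) htR
  have hfl1 : (1 : ℝ) ≤ ⌊t⌋₊ := by exact_mod_cast Nat.one_le_iff_ne_zero.2 (by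
    rintro h
    simp [h] at hfl)
  have hflt : (⌊t⌋₊ : ℝ) ≤ t := Nat.floor_le ht0.le
  have ht1 : 1 ≤ t := hfl1.trans hflt
  set δ := R - (1 - ⌊t⌋₊ / t) with hδ
  have hδ0 : 0 < δ := by
    have : 1 - R < ⌊t⌋₊ / t := by
      rw [lt_div_iff₀ ht0]
      linarith
    linarith
  have hδR : δ ≤ R := by
    have : (⌊t⌋₊ : ℝ) / t ≤ 1 := (div_le_one ht0).2 hflt
    linarith
  rw [le_div_iff₀ (by positivity)]
  rcases le_total (t ^ k) M with hMt | hMt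
  · have h1 : δ ^ (2 * k) ≤ 1 := pow_le_one₀ hδ0.le (hδR.trans hR1)
    calc _ ≤ 1 * (t ^ k * δ ^ (2 * k)) := by
          gcongr
          exact measureReal_le_one
      _ ≤ 1 * (M * 1) := by gcongr
      _ ≤ _ := by nlinarith [show 0 ≤ 2 ^ (2 * k) * C * M by positivity]
  · set m := ∫ x, V x ∂μ with hm
    have hm1 : |m| ≤ 1 := abs_integral_le_of_abs_le hV1
    -- The factor `2⁻¹` restores `|v| ≤ 1` after centering.
    let v : E → ℝ := fun x => 2⁻¹ * (V x - m)
    have hv : Measurable v := (hV.sub_const m).const_mul _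
    have hv1 : ∀ x, |v x| ≤ 1 := fun x => by
      have := (abs_sub (V x) m).trans (add_le_add (hV1 x) hm1)
      simp only [v, abs_mul, abs_of_pos (by norm_num : (0 : ℝ) < 2⁻¹)]
      linarith
    have hv0 : ∫ x, v x ∂μ = 0 := by
      simp only [v]
      rw [integral_const_mul, integral_sub (integrable_of_abs_le hV 1 hV1) (integrable_const _)]
      simp [hm]
    have hmom := hC Ω E Y μ hμ η hη α hα M hM0 hαM v hv hv1 hv0 t ht1 hMt
    let Z : Ω → ℝ := fun ω => ∫ s in (0 : ℝ)..t, v (Y.X s.toNNReal ω)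
    have hZm : Measurable Z := measurable_timeIntegral Y.measurable_uncurry hv 0 t
    have hZb : ∀ ω, |Z ω| ≤ t := fun ω => by
      have := intervalIntegral.norm_integral_le_of_norm_le_const (a := 0) (b := t) (C := 1)
        (f := fun s : ℝ => v (Y.X s.toNNReal ω)) fun s _ => hv1 _
      simpa [abs_of_pos ht0] using this
    have hZV : ∀ ω, 2 * Z ω = (∫ s in (0 : ℝ)..t, V (Y.X s.toNNReal ω)) - t * m := fun ω => by
      simp only [Z, v]
      rw [intervalIntegral.integral_const_mul, intervalIntegral.integral_sub]
      · simp
      · exact (intervalIntegrable_const (c := (1 : ℝ))).mono_fun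
          (measurable_comp_toNNReal Y.measurable_uncurry hV ω).aestronglyMeasurable
          (ae_of_all _ fun s => by simpa using hV1 _)
      · exact intervalIntegrable_const
    have hsub : {ω | R ≤ 1 / t * (∫ s in (0 : ℝ)..t, V (Y.X s.toNNReal ω)) - m} ⊆
        {ω | (t * R / 2) ^ (2 * k) ≤ Z ω ^ (2 * k)} := by
      intro ω hω
      simp only [Set.mem_ofPred_eq] at hω ⊢
      refine pow_le_pow_left₀ (by positivity) ?_ _
      have h1 := mul_le_mul_of_nonneg_left hω ht0.le
      have h2 : t * (1 / t * (∫ s in (0 : ℝ)..t, V (Y.X s.toNNReal ω)) - m) = 2 * Z ω := by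
        rw [hZV]
        field_simp
      linarith
    have hmarkov := mul_meas_ge_le_integral_of_nonneg (μ := Y.lawFrom μ)
      (f := fun ω => Z ω ^ (2 * k)) (ae_of_all _ fun ω => (even_two_mul k).pow_nonneg _)
      (integrable_of_abs_le (hZm.pow_const _) (t ^ (2 * k)) fun ω => by
        rw [abs_pow]
        exact pow_le_pow_left₀ (abs_nonneg _) (hZb ω) _) ((t * R / 2) ^ (2 * k))
    have hp := (mul_le_mul_of_nonneg_left (measureReal_mono (μ := Y.lawFrom μ) hsub)
      (by positivity : 0 ≤ (t * R / 2) ^ (2 * k))).trans (hmarkov.trans hmom)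
    set p := (Y.lawFrom μ).real
      {ω | R ≤ 1 / t * (∫ s in (0 : ℝ)..t, V (Y.X s.toNNReal ω)) - m}
    have hp0 : 0 ≤ p := measureReal_nonneg
    have ht0k : 0 < t ^ k := by positivity
    refine le_of_mul_le_mul_right ?_ ht0k
    -- Only here is `R` weakened to `δ`, through `δ ≤ R`.
    calc p * (t ^ k * δ ^ (2 * k)) * t ^ k ≤ p * (t ^ k * R ^ (2 * k)) * t ^ k := by gcongr
      _ = 2 ^ (2 * k) * ((t * R / 2) ^ (2 * k) * p) := by
          rw [div_pow, mul_pow, show t ^ (2 * k) = t ^ k * t ^ k by rw [two_mul, pow_add]]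
          field_simp
      _ ≤ 2 ^ (2 * k) * (C * M * t ^ k) := by gcongr
      _ ≤ _ := by nlinarith [mul_nonneg hM0 ht0k.le]
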